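/- Conventions. A unital C*-algebra is nonzero. A C*-algebra $B$ is simple if $B\neq 0$ and $0$ and $B$ are its only norm-closed two-sided ideals. A simple C*-algebra $B\not\cong\mathbb{C}$ is purely infinite if for all $a,b\in B$ with $a\neq 0$ there are $x,y\in B$ with $xay=b$. A C*-algebra $B$ is nuclear if for every finite $F\subseteq B$ and $\varepsilon>0$ there are $n$ and completely positive contractions $\varphi\colon B\to M_n(\mathbb{C})$ and $\psi\colon M_n(\mathbb{C})\to B$ with $\|\psi(\varphi(a))-a\|<\varepsilon$ for all $a\in F$. A Kirchberg algebra is a simple, purely infinite, separable, nuclear C*-algebra. Let $A$ be a unital C*-algebra and let $\alpha\colon\mathbb{T}\to\mathrm{Aut}(A)$ be an action of the circle group by $*$-automorphisms such that $\zeta\mapsto\alpha_\zeta(a)$ is norm continuous for every $a\in A$. The action $\alpha$ has the Rokhlin property if for every $\varepsilon>0$ and every finite subset $F\subseteq A$ there is a unitary $u\in A$ such that 1. $\|\alpha_\zeta(u)-\zeta u\|<\varepsilon$ for all $\zeta\in\mathbb{T}$, and 2. $\|ua-au\|<\varepsilon$ for all $a\in F$. Write $A^\alpha=\{a\in A:\alpha_\zeta(a)=a\text{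 for all }\zeta\in\mathbb{T}\}$ for the fixed point algebra and $A\rtimes_\alpha\mathbb{T}$ for the crossed product, that is, the enveloping C*-algebra of $L^1(\mathbb{T},A,\alpha)$: the Hausdorff completion of $C(\mathbb{T},A)$, with the operations $(f*g)(t)=\int_{\mathbb{T}}f(s)\,\alpha_s(g(s^{-1}t))\,ds$ and $f^*(t)=\alpha_t(f(t^{-1})^*)$ ($ds$ being normalized Haar measure), in the largest C*-seminorm dominated by the $L^1$-norm. **Theorem.** Let $A$ be a unital Kirchberg algebra and let $\alpha\colon\mathbb{T}\to\mathrm{Aut}(A)$ be an action with the Rokhlin property. Then both $A^\alpha$ and $A\rtimes_\alpha\mathbb{T}$ are Kirchberg algebras. -/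

import Mathlib

open MeasureTheory UniformSpace
open scoped CStarAlgebra ComplexOrder

noncomputable section

/-! ## Kirchberg algebras -/

section Kirchberg

variable (A : Type*) [NonUnitalCStarAlgebra A]

/-- A C⋆-algebra is simple if it is nonzero and its only norm-closed two-sided ideals are
`0` and the whole algebra. -/
structure IsCStarSimple : Prop where
  nontrivial : Nontrivial A
  eq_bot_or_eq_top : ∀ I : TwoSidedIdeal A, IsClosed (I : Set A) → I = ⊥ ∨ I = ⊤

/-- A simple C⋆-algebra, other than the complex numbers, is purely infinite if for all `a` and `b`
with `a ≠ 0` there are `x` and `y` with `x a y = b`. (The field `ℂ`, which satisfies the last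
condition trivially, is not purely infinite.) -/
structure IsPurelyInfiniteSimple : Prop where
  simple : IsCStarSimple A
  not_complex : IsEmpty (A ≃⋆ₐ[ℂ] ℂ)
  exists_mul_mul_eq : ∀ a b : A, a ≠ 0 → ∃ x y : A, x * a * y = b

/-- Nuclearity: the identity map of `A` is a point-norm limit of completely positive contractions
which factor through matrix algebras `M_n(ℂ)` by completely positive contractions
(the order on `A` is the usual one, whose positive elements are those of the form `c⋆ c`). -/
def IsNuclearCStar : Prop :=
  letI : PartialOrder A := CStarAlgebra.spectralOrder A
  haveI : StarOrderedRing A := CStarAlgebra.spectralOrderedRing A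
  ∀ (F : Finset A) (ε : ℝ), 0 < ε →
    ∃ (n : ℕ) (φ : A →CP CStarMatrix (Fin n) (Fin n) ℂ) (ψ : CStarMatrix (Fin n) (Fin n) ℂ →CP A),
      (∀ a, ‖φ a‖ ≤ ‖a‖) ∧ (∀ x, ‖ψ x‖ ≤ ‖x‖) ∧ ∀ a ∈ F, ‖ψ (φ a) - a‖ < ε

/-- A Kirchberg algebra is a purely infinite simple, separable, nuclear C⋆-algebra. -/
structure IsKirchbergAlgebra : Prop where
  purelyInfiniteSimple : IsPurelyInfiniteSimple A
  separable : TopologicalSpace.SeparableSpace A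
  nuclear : IsNuclearCStar A

end Kirchberg

/-! ## Circle actions -/

/-- A (point-norm) continuous action of the circle group on `A` by ⋆-automorphisms. -/
structure CircleAction (A : Type*) [CStarAlgebra A] where
  toHom : Circle →* (A ≃⋆ₐ[ℂ] A)
  continuous_apply : ∀ a : A, Continuous fun ζ : Circle => toHom ζ a

namespace CircleAction

variable {A : Type*} [CStarAlgebra A] (α : CircleAction A)

instance : CoeFun (CircleAction A) fun _ => Circle → (A ≃⋆ₐ[ℂ] A) := ⟨fun α => α.toHom⟩

/-- The Rokhlin property of a circle action on a unital C⋆-algebra. -/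
def HasRokhlinProperty : Prop :=
  ∀ (ε : ℝ), 0 < ε → ∀ F : Finset A, ∃ u ∈ unitary A,
    (∀ ζ : Circle, ‖α ζ u - (ζ : ℂ) • u‖ < ε) ∧ ∀ a ∈ F, ‖u * a - a * u‖ < ε

/-- The fixed point algebra `A^α`. -/
def fixedPointAlgebra : StarSubalgebra ℂ A where
  carrier := {a | ∀ ζ : Circle, α ζ a = a}
  mul_mem' ha hb ζ := by rw [map_mul, ha ζ, hb ζ]
  add_mem' ha hb ζ := by rw [map_add, ha ζ, hb ζ]
  algebraMap_mem' r ζ := by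
    rw [Algebra.algebraMap_eq_smul_one, map_smul, map_one]
  star_mem' ha ζ := by rw [map_star, ha ζ]

/-- The fixed point algebra is norm closed, hence a C⋆-algebra (via Mathlib's instance for closed
⋆-subalgebras). -/
instance isClosed_fixedPointAlgebra : IsClosed (α.fixedPointAlgebra : Set A) := by
  have : (α.fixedPointAlgebra : Set A) = ⋂ ζ : Circle, {a | α ζ a = a} := by
    ext a; simp [fixedPointAlgebra]
  rw [this]
  exact isClosed_iInter fun ζ =>
    isClosed_eq (StarAlgEquiv.isometry (α ζ)).continuous continuous_id

/-! ## The crossed product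

`A ⋊_α 𝕋` is the enveloping C⋆-algebra of `L¹(𝕋, A, α)`: the Hausdorff completion of the twisted
convolution ⋆-algebra `C(𝕋, A)` with respect to the largest C⋆-seminorm that is dominated by the
`L¹`-norm. -/

instance : MeasurableSpace Circle := borel Circle
instance : BorelSpace Circle := ⟨rfl⟩

/-- Normalized Haar measure on the circle group. -/
def haar : Measure Circle := Measure.haarMeasure ⊤

instance : Measure.IsHaarMeasure haar := by unfold haar; infer_instance

lemma continuous_uncurry : Continuous fun p : Circle × A => α p.1 p.2 := by
  rw [continuous_iff_continuousAt]
  rintro ⟨ζ, a⟩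
  rw [ContinuousAt, tendsto_iff_norm_sub_tendsto_zero]
  have h1 : Filter.Tendsto (fun p : Circle × A => ‖p.2 - a‖ + ‖α p.1 a - α ζ a‖)
      (nhds (ζ, a)) (nhds 0) := by
    have : Continuous fun p : Circle × A => ‖p.2 - a‖ + ‖α p.1 a - α ζ a‖ := by
      have := (α.continuous_apply a).comp (continuous_fst (X := Circle) (Y := A))
      simp only [Function.comp_def] at this
      fun_prop
    simpa using this.tendsto (ζ, a)
  refine squeeze_zero (fun _ => norm_nonneg _) (fun p => ?_) h1
  have h2 : α p.1 p.2 - α ζ a = α p.1 (p.2 - a) + (α p.1 a - α ζ a) := by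
    rw [map_sub]; abel
  rw [h2]
  refine (norm_add_le _ _).trans ?_
  rw [StarAlgEquiv.norm_map]

lemma continuous_act {X : Type*} [TopologicalSpace X] {f : X → Circle} {g : X → A}
    (hf : Continuous f) (hg : Continuous g) : Continuous fun x => α (f x) (g x) :=
  α.continuous_uncurry.comp (hf.prodMk hg)

lemma act_act (s t : Circle) (a : A) : α s (α t a) = α (s * t) a := by
  rw [map_mul]; rfl

lemma act_one (a : A) : α 1 a = a := by
  rw [map_one]; rfl

/-- The action of a group element as a continuous linear map. -/
def actL (t : Circle) : A →L[ℂ] A where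
  toFun := α t
  map_add' := map_add (α t)
  map_smul' := map_smul (α t)
  cont := (StarAlgEquiv.isometry (α t)).continuous

lemma integrable_haar {f : Circle → A} (hf : Continuous f) : Integrable f haar :=
  hf.integrable_of_hasCompactSupport (HasCompactSupport.of_compactSpace f)

lemma act_integral (t : Circle) {f : Circle → A} (hf : Continuous f) :
    α t (∫ s, f s ∂haar) = ∫ s, α t (f s) ∂haar :=
  ((α.actL t).integral_comp_comm (integrable_haar hf)).symm

/-- The vector space `C(𝕋, A)`, to be equipped with the convolution and involution twisted by the
action `α`. -/
def ConvAlg (_α : CircleAction A) : Type _ := C(Circle, A)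

namespace ConvAlg

variable {α}

instance : AddCommGroup (ConvAlg α) := inferInstanceAs (AddCommGroup C(Circle, A))
instance : Module ℂ (ConvAlg α) := inferInstanceAs (Module ℂ C(Circle, A))
instance : FunLike (ConvAlg α) Circle A := inferInstanceAs (FunLike C(Circle, A) Circle A)

@[ext] lemma ext {f g : ConvAlg α} (h : ∀ t, f t = g t) : f = g := ContinuousMap.ext h

@[fun_prop] lemma continuous (f : ConvAlg α) : Continuous f := ContinuousMap.continuous f

@[simp] lemma add_apply (f g : ConvAlg α) (t : Circle) : (f + g) t = f t + g t := rfl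
@[simp] lemma zero_apply (t : Circle) : (0 : ConvAlg α) t = 0 := rfl
@[simp] lemma smul_apply (c : ℂ) (f : ConvAlg α) (t : Circle) : (c • f) t = c • f t := rfl

lemma continuous_integrand (f g : ConvAlg α) :
    Continuous fun p : Circle × Circle => f p.2 * α p.2 (g (p.2⁻¹ * p.1)) := by
  have := α.continuous_act (X := Circle × Circle) (f := fun p => p.2)
    (g := fun p => g (p.2⁻¹ * p.1)) (by fun_prop) (by fun_prop)
  fun_prop

lemma continuous_integral {F : Circle → Circle → A} (hF : Continuous F.uncurry) :
    Continuous fun t => ∫ s, F t s ∂haar := by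
  have := continuous_parametric_integral_of_continuous (μ := haar) hF isCompact_univ
  simpa using this

/-- Twisted convolution: `(f * g)(t) = ∫ f(s) α_s(g(s⁻¹ t)) ds`. -/
instance : Mul (ConvAlg α) where
  mul f g := (⟨fun t => ∫ s, f s * α s (g (s⁻¹ * t)) ∂haar,
    continuous_integral (F := fun t s => f s * α s (g (s⁻¹ * t)))
      (continuous_integrand f g)⟩ : C(Circle, A))

/-- Twisted involution: `f⋆(t) = α_t(f(t⁻¹)⋆)`. -/
instance : Star (ConvAlg α) where
  star f := (⟨fun t => α t (star (f t⁻¹)),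
    α.continuous_act continuous_id (by fun_prop)⟩ : C(Circle, A))

lemma mul_apply (f g : ConvAlg α) (t : Circle) :
    (f * g) t = ∫ s, f s * α s (g (s⁻¹ * t)) ∂haar := rfl

lemma star_apply (f : ConvAlg α) (t : Circle) : star f t = α t (star (f t⁻¹)) := rfl

lemma continuous_integrand_left (f g : ConvAlg α) (t : Circle) :
    Continuous fun s => f s * α s (g (s⁻¹ * t)) :=
  (continuous_integrand f g).comp (Continuous.prodMk continuous_const continuous_id)

lemma integrable_integrand (f g : ConvAlg α) (t : Circle) :
    Integrable (fun s => f s * α s (g (s⁻¹ * t))) haar :=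
  integrable_haar (continuous_integrand_left f g t)

protected lemma mul_assoc (f g h : ConvAlg α) : f * g * h = f * (g * h) := by
  ext t
  have hL : (f * g * h) t =
      ∫ r, ∫ s, f s * α s (g (s⁻¹ * r)) * α r (h (r⁻¹ * t)) ∂haar ∂haar := by
    rw [mul_apply]
    congr 1 with r
    rw [mul_apply]
    exact (integral_mul_const_of_integrable (integrable_integrand f g r)).symm
  have hR : (f * (g * h)) t =
      ∫ s, ∫ r, f s * α s (g (s⁻¹ * r)) * α r (h (r⁻¹ * t)) ∂haar ∂haar := by
    rw [mul_apply]
    congr 1 with s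
    rw [mul_apply, α.act_integral s (continuous_integrand_left g h _)]
    have hc : Continuous fun r => α s (g r * α r (h (r⁻¹ * (s⁻¹ * t)))) :=
      α.continuous_act continuous_const (continuous_integrand_left g h _)
    rw [← integral_const_mul_of_integrable (integrable_haar hc)]
    rw [← integral_mul_left_eq_self _ s⁻¹]
    congr 1 with r
    rw [map_mul, act_act, ← mul_assoc, mul_inv_cancel_left,
      show (s⁻¹ * r)⁻¹ * (s⁻¹ * t) = r⁻¹ * t by group]
  rw [hL, hR]
  refine integral_integral_swap_of_hasCompactSupport ?_ (HasCompactSupport.of_compactSpace _)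
  have h1 := α.continuous_act (X := Circle × Circle) (f := fun p => p.2)
    (g := fun p => g (p.2⁻¹ * p.1)) (by fun_prop) (by fun_prop)
  have h2 := α.continuous_act (X := Circle × Circle) (f := fun p => p.1)
    (g := fun p => h (p.1⁻¹ * t)) (by fun_prop) (by fun_prop)
  simp only [Function.uncurry_def]
  fun_prop

instance : NonUnitalRing (ConvAlg α) where
  left_distrib f g h := by
    ext t
    simp only [mul_apply, add_apply, map_add, mul_add]
    exact integral_add (integrable_integrand f g t) (integrable_integrand f h t)
  right_distrib f g h := by
    ext t
    simp only [mul_apply, add_apply, add_mul]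
    exact integral_add (integrable_integrand f h t) (integrable_integrand g h t)
  zero_mul f := by ext t; simp [mul_apply]
  mul_zero f := by ext t; simp [mul_apply]
  mul_assoc := ConvAlg.mul_assoc

instance : StarRing (ConvAlg α) where
  star_involutive f := by
    ext t
    rw [star_apply, star_apply, ← map_star, star_star, act_act, mul_inv_cancel, act_one, inv_inv]
  star_mul f g := by
    ext t
    rw [star_apply, mul_apply, mul_apply,
      ← integral_mul_left_eq_self (fun s => star g s * α s (star f (s⁻¹ * t))) t]
    have hc := continuous_integrand_left f g t⁻¹
    rw [show star (∫ s, f s * α s (g (s⁻¹ * t⁻¹)) ∂haar) =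
      ∫ s, star (f s * α s (g (s⁻¹ * t⁻¹))) ∂haar from
        ((starL' ℝ (A := A)).toContinuousLinearMap.integral_comp_comm (integrable_haar hc)).symm]
    rw [act_integral α t (by fun_prop)]
    congr 1 with s
    rw [star_mul, map_mul, ← map_star, act_act, star_apply, star_apply, act_act,
      show (t * s)⁻¹ = s⁻¹ * t⁻¹ by group, show t * s * (s⁻¹ * t⁻¹ * t) = t by group,
      show (s⁻¹ * t⁻¹ * t)⁻¹ = s by group]
  star_add f g := by ext t; simp [star_apply]

instance : StarModule ℂ (ConvAlg α) where
  star_smul c f := by ext t; simp [star_apply]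

instance : IsScalarTower ℂ (ConvAlg α) (ConvAlg α) where
  smul_assoc c f g := by
    ext t
    simp only [smul_eq_mul, mul_apply, smul_apply, smul_mul_assoc]
    exact integral_smul c _

instance : SMulCommClass ℂ (ConvAlg α) (ConvAlg α) where
  smul_comm c f g := by
    ext t
    simp only [smul_eq_mul, mul_apply, smul_apply, map_smul, mul_smul_comm]
    exact (integral_smul c _).symm

/-- C⋆-seminorms on the twisted convolution algebra that are dominated by the `L¹`-norm. -/
structure IsCStarSeminorm (p : Seminorm ℂ (ConvAlg α)) : Prop where
  mul_le : ∀ f g, p (f * g) ≤ p f * p g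
  star_mul_self : ∀ f, p (star f * f) = p f * p f
  le_integral_norm : ∀ f, p f ≤ ∫ t, ‖f t‖ ∂haar

variable (α) in
/-- The universal C⋆-norm: the supremum of all C⋆-seminorms dominated by the `L¹`-norm. -/
def universalSeminorm : Seminorm ℂ (ConvAlg α) := sSup {p | IsCStarSeminorm p}

lemma isCStarSeminorm_zero : IsCStarSeminorm (0 : Seminorm ℂ (ConvAlg α)) where
  mul_le _ _ := by simp
  star_mul_self _ := by simp
  le_integral_norm _ := by
    simpa using integral_nonneg fun _ => norm_nonneg _

instance : Nonempty {p : Seminorm ℂ (ConvAlg α) // p ∈ {p | IsCStarSeminorm p}} :=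
  ⟨⟨0, isCStarSeminorm_zero⟩⟩

lemma universalSeminorm_apply (f : ConvAlg α) : universalSeminorm α f =
    ⨆ p : {p : Seminorm ℂ (ConvAlg α) // p ∈ {p | IsCStarSeminorm p}}, p.1 f := by
  refine Seminorm.sSup_apply (Seminorm.bddAbove_iff.mpr ?_)
  refine ⟨fun f => ∫ t, ‖f t‖ ∂haar, ?_⟩
  rintro _ ⟨p, hp, rfl⟩ f
  exact hp.le_integral_norm f

lemma bddAbove_range (f : ConvAlg α) : BddAbove (Set.range
    fun p : {p : Seminorm ℂ (ConvAlg α) // p ∈ {p | IsCStarSeminorm p}} => p.1 f) := by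
  refine ⟨∫ t, ‖f t‖ ∂haar, ?_⟩
  rintro _ ⟨p, rfl⟩
  exact p.2.le_integral_norm f

lemma le_universalSeminorm {p : Seminorm ℂ (ConvAlg α)} (hp : IsCStarSeminorm p)
    (f : ConvAlg α) : p f ≤ universalSeminorm α f := by
  rw [universalSeminorm_apply]
  exact le_ciSup (bddAbove_range f) ⟨p, hp⟩

/-- The universal C⋆-norm is itself a C⋆-seminorm dominated by the `L¹`-norm. -/
lemma isCStarSeminorm_universalSeminorm : IsCStarSeminorm (universalSeminorm α) where
  mul_le f g := by
    rw [universalSeminorm_apply (f * g)]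
    refine ciSup_le fun p => (p.2.mul_le f g).trans ?_
    exact mul_le_mul (le_universalSeminorm p.2 f) (le_universalSeminorm p.2 g)
      (apply_nonneg _ _) (apply_nonneg _ _)
  star_mul_self f := by
    refine le_antisymm ?_ ?_
    · rw [universalSeminorm_apply (star f * f)]
      refine ciSup_le fun p => (p.2.star_mul_self f).le.trans ?_
      exact mul_le_mul (le_universalSeminorm p.2 f) (le_universalSeminorm p.2 f)
        (apply_nonneg _ _) (apply_nonneg _ _)
    · refine (Real.le_sqrt (apply_nonneg _ _) (apply_nonneg _ _)).mp ?_ |> fun h => by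
        simpa [sq] using h
      rw [universalSeminorm_apply f]
      refine ciSup_le fun p => Real.le_sqrt_of_sq_le ?_
      rw [sq, ← p.2.star_mul_self f]
      exact le_universalSeminorm p.2 _
  le_integral_norm f := by
    rw [universalSeminorm_apply]
    exact ciSup_le fun p => p.2.le_integral_norm f

/-- From now on, the convolution algebra carries the universal C⋆-seminorm. -/
instance : SeminormedAddCommGroup (ConvAlg α) :=
  (universalSeminorm α).toAddGroupSeminorm.toSeminormedAddCommGroup

lemma norm_def (f : ConvAlg α) : ‖f‖ = universalSeminorm α f := rfl

instance : NormedSpace ℂ (ConvAlg α) where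
  norm_smul_le c f := (map_smul_eq_mul (universalSeminorm α) c f).le

instance : NonUnitalSeminormedRing (ConvAlg α) where
  __ := (inferInstance : SeminormedAddCommGroup (ConvAlg α))
  __ := (inferInstance : NonUnitalRing (ConvAlg α))
  norm_mul_le := isCStarSeminorm_universalSeminorm.mul_le

lemma norm_star_mul_self (f : ConvAlg α) : ‖star f * f‖ = ‖f‖ * ‖f‖ :=
  isCStarSeminorm_universalSeminorm.star_mul_self f

lemma norm_le_norm_star (f : ConvAlg α) : ‖f‖ ≤ ‖star f‖ := by
  have h := norm_star_mul_self f
  have h' := norm_mul_le (star f) f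
  rw [h] at h'
  rcases (norm_nonneg f).eq_or_lt with h0 | h0
  · rw [← h0]; exact norm_nonneg _
  · exact le_of_mul_le_mul_right h' h0

instance : NormedStarGroup (ConvAlg α) where
  norm_star_le f := by simpa using norm_le_norm_star (star f)

end ConvAlg

/-- The crossed product `A ⋊_α 𝕋`. -/
def CrossedProduct : Type _ := Completion (ConvAlg α)

namespace CrossedProduct

variable {α}

instance : NormedAddCommGroup (CrossedProduct α) :=
  inferInstanceAs (NormedAddCommGroup (Completion (ConvAlg α)))
instance : NormedSpace ℂ (CrossedProduct α) :=
  inferInstanceAs (NormedSpace ℂ (Completion (ConvAlg α)))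
instance : CompleteSpace (CrossedProduct α) :=
  inferInstanceAs (CompleteSpace (Completion (ConvAlg α)))

/-- The canonical map of the convolution algebra into the crossed product. -/
def of : ConvAlg α →ₗᵢ[ℂ] CrossedProduct α := Completion.toComplₗᵢ

lemma isDenseInducing_of : IsDenseInducing (of : ConvAlg α → CrossedProduct α) :=
  Completion.isDenseInducing_coe

lemma continuous_of : Continuous (of : ConvAlg α → CrossedProduct α) := of.continuous

/-- The multiplication of the crossed product extends the convolution by continuity. -/
@[irreducible] def mulFun (x y : CrossedProduct α) : CrossedProduct α :=
  (isDenseInducing_of.prodMap isDenseInducing_of).extend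
    (fun p : ConvAlg α × ConvAlg α => of (p.1 * p.2)) (x, y)

/-- The involution of the crossed product extends that of the convolution algebra by continuity. -/
@[irreducible] def starFun : CrossedProduct α → CrossedProduct α :=
  isDenseInducing_of.extend fun f : ConvAlg α => of (star f)

instance : Mul (CrossedProduct α) := ⟨mulFun⟩
instance : Star (CrossedProduct α) := ⟨starFun⟩

lemma of_mul (f g : ConvAlg α) : of (f * g) = of f * of g := by
  change _ = mulFun _ _
  unfold mulFun
  exact ((isDenseInducing_of.prodMap isDenseInducing_of).extend_eq
    (continuous_of.comp continuous_mul) (f, g)).symm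

lemma of_star (f : ConvAlg α) : of (star f) = star (of f) := by
  change _ = starFun _
  unfold starFun
  exact (isDenseInducing_of.extend_eq (continuous_of.comp continuous_star) f).symm

instance : ContinuousMul (CrossedProduct α) where
  continuous_mul := by
    let m := (AddMonoidHom.mul : ConvAlg α →+ ConvAlg α →+ ConvAlg α).compr₂
      (of (α := α)).toLinearMap.toAddMonoidHom
    have hm : Continuous fun p : ConvAlg α × ConvAlg α => m p.1 p.2 :=
      continuous_of.comp continuous_mul
    have di : IsDenseInducing ((of (α := α)).toLinearMap.toAddMonoidHom) := isDenseInducing_of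
    change Continuous fun p : CrossedProduct α × CrossedProduct α => mulFun p.1 p.2
    unfold mulFun
    exact di.extend_Z_bilin di hm

instance : ContinuousStar (CrossedProduct α) where
  continuous_star := by
    have h : UniformContinuous fun f : ConvAlg α => of (star f) :=
      of.isometry.uniformContinuous.comp (starₗᵢ ℂ (E := ConvAlg α)).isometry.uniformContinuous
    change Continuous (starFun (α := α))
    unfold starFun
    exact uniformContinuous_uniformly_extend
      (Completion.isUniformInducing_coe (ConvAlg α)) Completion.denseRange_coe h |>.continuous

@[elab_as_elim]
lemma induction_on {p : CrossedProduct α → Prop} (x : CrossedProduct α)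
    (hp : IsClosed {x | p x}) (h : ∀ f, p (of f)) : p x :=
  isDenseInducing_of.dense.induction_on x hp h

protected lemma mul_add (x y z : CrossedProduct α) : x * (y + z) = x * y + x * z := by
  induction x using induction_on with
  | hp => exact isClosed_eq (by fun_prop) (by fun_prop)
  | h f =>
  induction y using induction_on with
  | hp => exact isClosed_eq (by fun_prop) (by fun_prop)
  | h g =>
  induction z using induction_on with
  | hp => exact isClosed_eq (by fun_prop) (by fun_prop)
  | h k =>
  simp only [← map_add, ← of_mul, _root_.mul_add]

protected lemma add_mul (x y z : CrossedProduct α) : (x + y) * z = x * z + y * z := by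
  induction x using induction_on with
  | hp => exact isClosed_eq (by fun_prop) (by fun_prop)
  | h f =>
  induction y using induction_on with
  | hp => exact isClosed_eq (by fun_prop) (by fun_prop)
  | h g =>
  induction z using induction_on with
  | hp => exact isClosed_eq (by fun_prop) (by fun_prop)
  | h k =>
  simp only [← map_add, ← of_mul, _root_.add_mul]

protected lemma mul_assoc (x y z : CrossedProduct α) : x * y * z = x * (y * z) := by
  induction x using induction_on with
  | hp => exact isClosed_eq (by fun_prop) (by fun_prop)
  | h f =>
  induction y using induction_on with
  | hp => exact isClosed_eq (by fun_prop) (by fun_prop)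
  | h g =>
  induction z using induction_on with
  | hp => exact isClosed_eq (by fun_prop) (by fun_prop)
  | h k =>
  simp only [← of_mul, _root_.mul_assoc]

protected lemma star_star (x : CrossedProduct α) : star (star x) = x := by
  induction x using induction_on with
  | hp => exact isClosed_eq (by fun_prop) (by fun_prop)
  | h f =>
  simp only [← of_star, _root_.star_star]

protected lemma star_mul (x y : CrossedProduct α) : star (x * y) = star y * star x := by
  induction x using induction_on with
  | hp => exact isClosed_eq (by fun_prop) (by fun_prop)
  | h f =>
  induction y using induction_on with
  | hp => exact isClosed_eq (by fun_prop) (by fun_prop)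
  | h g =>
  simp only [← of_mul, ← of_star, StarMul.star_mul]

protected lemma star_add (x y : CrossedProduct α) : star (x + y) = star x + star y := by
  induction x using induction_on with
  | hp => exact isClosed_eq (by fun_prop) (by fun_prop)
  | h f =>
  induction y using induction_on with
  | hp => exact isClosed_eq (by fun_prop) (by fun_prop)
  | h g =>
  simp only [← map_add, ← of_star, StarAddMonoid.star_add]

protected lemma norm_mul_le (x y : CrossedProduct α) : ‖x * y‖ ≤ ‖x‖ * ‖y‖ := by
  induction x using induction_on with
  | hp => exact isClosed_le (by fun_prop) (by fun_prop)
  | h f =>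
  induction y using induction_on with
  | hp => exact isClosed_le (by fun_prop) (by fun_prop)
  | h g =>
  simpa only [← of_mul, LinearIsometry.norm_map] using _root_.norm_mul_le f g

protected lemma norm_mul_self_le (x : CrossedProduct α) : ‖x‖ * ‖x‖ ≤ ‖star x * x‖ := by
  induction x using induction_on with
  | hp => exact isClosed_le (by fun_prop) (by fun_prop)
  | h f =>
  simpa only [← of_star, ← of_mul, LinearIsometry.norm_map] using
    (ConvAlg.norm_star_mul_self f).ge

lemma continuous_smul_mul (c : ℂ) (y : CrossedProduct α) :
    Continuous fun x : CrossedProduct α => c • (x * y) :=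
  (continuous_id.mul continuous_const).const_smul c

lemma continuous_smul_mul' (c : ℂ) (y : CrossedProduct α) :
    Continuous fun x : CrossedProduct α => c • (y * x) :=
  (continuous_const.mul continuous_id).const_smul c

lemma continuous_smul' (c : ℂ) : Continuous fun x : CrossedProduct α => c • x :=
  continuous_const_smul c

protected lemma smul_mul (c : ℂ) (x y : CrossedProduct α) : c • x * y = c • (x * y) := by
  induction x using induction_on with
  | hp => exact isClosed_eq ((continuous_smul' c).mul continuous_const) (continuous_smul_mul c y)
  | h f =>
  induction y using induction_on with
  | hp => exact isClosed_eq (continuous_const.mul continuous_id) (continuous_smul_mul' c (of f))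
  | h g => simp only [← map_smul, ← of_mul, smul_mul_assoc]

protected lemma mul_smul (c : ℂ) (x y : CrossedProduct α) : x * c • y = c • (x * y) := by
  induction x using induction_on with
  | hp => exact isClosed_eq (continuous_id.mul continuous_const) (continuous_smul_mul c y)
  | h f =>
  induction y using induction_on with
  | hp => exact isClosed_eq (continuous_const.mul (continuous_smul' c))
            (continuous_smul_mul' c (of f))
  | h g => simp only [← map_smul, ← of_mul, mul_smul_comm]

protected lemma star_smul (c : ℂ) (x : CrossedProduct α) : star (c • x) = star c • star x := by
  induction x using induction_on with
  | hp => exact isClosed_eq (continuous_smul' c).star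
            ((continuous_smul' (star c)).comp continuous_star)
  | h f => rw [← map_smul, ← of_star, ← of_star, ← map_smul, StarModule.star_smul]

/-- The crossed product is a C⋆-algebra. -/
instance : NonUnitalCStarAlgebra (CrossedProduct α) where
  __ := (inferInstance : NormedAddCommGroup (CrossedProduct α))
  __ := (inferInstance : NormedSpace ℂ (CrossedProduct α))
  __ := (inferInstance : CompleteSpace (CrossedProduct α))
  left_distrib := CrossedProduct.mul_add
  right_distrib := CrossedProduct.add_mul
  mul_assoc := CrossedProduct.mul_assoc
  zero_mul x := by simpa using CrossedProduct.add_mul 0 0 x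
  mul_zero x := by simpa using CrossedProduct.mul_add x 0 0
  norm_mul_le := CrossedProduct.norm_mul_le
  star_involutive := CrossedProduct.star_star
  star_mul := CrossedProduct.star_mul
  star_add := CrossedProduct.star_add
  norm_mul_self_le := CrossedProduct.norm_mul_self_le
  smul_assoc := CrossedProduct.smul_mul
  smul_comm c x y := (CrossedProduct.mul_smul c x y).symm
  star_smul := CrossedProduct.star_smul

end CrossedProduct

end CircleAction

end

noncomputable section

/-! ## Generalities on C⋆-algebras -/

/-! ### Positivity reflected by injective ⋆-homomorphisms. -/

section Reflect

variable {A B : Type*} [NonUnitalCStarAlgebra A] [NonUnitalCStarAlgebra B] [PartialOrder A]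
  [PartialOrder B] [StarOrderedRing A] [StarOrderedRing B]

/-! Averaging a Rokhlin unitary against the first character and taking a polar decomposition gives
unitaries `u` with `α_ζ(u) = ζ u` exactly, still approximately central (`exists_unitary`). Such a
`u` trivialises the grading of `A` by its spectral subspaces `A_n`: the map `c ↦ c u^(-n)` carries
`A_n` onto `A^α`.

Fixed point algebra. Sending a trigonometric polynomial `∑ c_n` to `∑ c_n u^(-n)` lands in `A^α`,
fixes `A^α` and, along an asymptotically central net of such `u`, is asymptotically multiplicative,
⋆-preserving and contractive. Contractivity (`IsEvaluation.eventually_norm_lt`) is the crux: degree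
`N` costs a factor of at most `2N + 1`, which is removed by passing to powers of `a⋆a`. For nonzero
`a` in `A^α`, pure infiniteness of `A` gives `z` with `z⋆ a⋆ a z = 1`; approximating `z` by a
polynomial and evaluating gives `b` in `A^α` with `b⋆ a⋆ a b` invertible (`exists_mul_mul_eq_one`).
This yields simplicity and pure infiniteness together. Nuclearity passes to `A^α` through the
averaging expectation, and `A^α ≅ ℂ` would force `A_n = ℂ u^n`, making `A` commutative.

Crossed product. One equivariant `u` is enough: the functions `t ↦ t^j u^(-i) b u^j` multiply like
`b ⊗ e i j` and have dense span, so the crossed product is the stabilization of `A^α`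
(`stabilizationData`). Faithfulness of the corners follows from simplicity of `A^α` once the
universal norm is known to be nonzero on the constant `1`; this is seen in the regular
representation on `A`, viewed as a Hilbert module over `A^α`. Finally, a sequence of isometries with
orthogonal ranges squeezes the stabilization into one corner, which transfers all Kirchberg
properties (`StabilizationData.isKirchbergAlgebra`). -/

lemma CStarAlgebra.exists_eq_star_mul_self_of_nonneg {x : A} (hx : 0 ≤ x) :
    ∃ y, x = star y * y :=
  CStarAlgebra.nonneg_iff_eq_star_mul_self.mp hx

/-- An injective ⋆-homomorphism of C⋆-algebras reflects positivity. -/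
lemma NonUnitalStarAlgHom.nonneg_of_map_nonneg (f : A →⋆ₙₐ[ℂ] B) (hf : Function.Injective f)
    {x : A} (hx : 0 ≤ f x) : 0 ≤ x := by
  have hsa : IsSelfAdjoint x := hf (by rw [map_star]; exact (IsSelfAdjoint.of_nonneg hx).star_eq)
  rw [CStarAlgebra.nonneg_iff_isSelfAdjoint_and_negPart_eq_zero]
  refine ⟨hsa, ?_⟩
  have hneg : 0 ≤ x⁻ := CFC.negPart_nonneg x
  have hnsa : star x⁻ = x⁻ := (IsSelfAdjoint.of_nonneg hneg).star_eq
  -- Compressing `x` by its negative part gives minus the cube of `x⁻`. The image of that cube is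
  -- then both positive and negative, hence zero.
  have h1 : x⁻ * x * x⁻ = -(x⁻ * x⁻ * x⁻) := by
    have h := congrArg (fun y => x⁻ * y * x⁻) (CFC.posPart_sub_negPart x hsa)
    simpa only [mul_sub, CFC.negPart_mul_posPart, zero_sub, neg_mul] using h.symm
  have h2 : 0 ≤ f (x⁻ * x⁻ * x⁻) := by
    apply map_nonneg
    have := star_left_conjugate_nonneg hneg x⁻
    rwa [hnsa] at this
  have h3 : 0 ≤ -f (x⁻ * x⁻ * x⁻) := by
    have := star_left_conjugate_nonneg hx (f x⁻)
    rwa [← map_star, hnsa, ← map_mul, ← map_mul, h1, map_neg] at this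
  have h4 : x⁻ * x⁻ * x⁻ = 0 := by
    apply hf
    rw [map_zero]
    exact le_antisymm (neg_nonneg.mp h3) h2
  have h5 : star (x⁻ * x⁻) * (x⁻ * x⁻) = 0 := by
    rw [star_mul, hnsa, ← mul_assoc, h4, zero_mul]
  have h6 : star x⁻ * x⁻ = 0 := by
    rw [hnsa]; exact CStarRing.star_mul_self_eq_zero_iff _ |>.mp h5
  exact CStarRing.star_mul_self_eq_zero_iff _ |>.mp h6

/-- An injective ⋆-homomorphism reflects positivity of matrices. -/
lemma CStarMatrix.nonneg_of_map_nonneg {k : ℕ} (f : A →⋆ₙₐ[ℂ] B) (hf : Function.Injective f)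
    {M : CStarMatrix (Fin k) (Fin k) A} (hM : 0 ≤ M.map f) : 0 ≤ M :=
  NonUnitalStarAlgHom.nonneg_of_map_nonneg (CStarMatrix.mapₙₐ f)
    (CStarMatrix.map_injective hf) hM

end Reflect

/-! ### Completely positive maps and nuclearity. -/

section CompletelyPositive

variable {A B C : Type*} [NonUnitalCStarAlgebra A] [NonUnitalCStarAlgebra B]
  [NonUnitalCStarAlgebra C] [PartialOrder A] [PartialOrder B] [PartialOrder C]
  [StarOrderedRing A] [StarOrderedRing B] [StarOrderedRing C]

/-- Composition of completely positive maps. -/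
def CompletelyPositiveMap.comp (g : B →CP C) (f : A →CP B) : A →CP C where
  toLinearMap := g.toLinearMap ∘ₗ f.toLinearMap
  map_cstarMatrix_nonneg' k M hM :=
    g.map_cstarMatrix_nonneg' k _ (f.map_cstarMatrix_nonneg' k M hM)

/-- A ⋆-homomorphism as a completely positive map. -/
def CompletelyPositiveMap.ofStarHom (f : A →⋆ₙₐ[ℂ] B) : A →CP B where
  toFun := f
  map_add' := map_add f
  map_smul' := map_smul f
  map_cstarMatrix_nonneg' k M hM := by
    change 0 ≤ (CStarMatrix.mapₙₐ f) M
    exact map_nonneg _ hM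

/-- The completely positive map `x ↦ d⋆ x d`. -/
def CompletelyPositiveMap.conj (d : A) : A →CP A where
  toFun x := star d * x * d
  map_add' x y := by rw [mul_add, add_mul]
  map_smul' c x := by simp [mul_smul_comm, smul_mul_assoc]
  map_cstarMatrix_nonneg' k M hM := by
    obtain ⟨N, rfl⟩ := CStarAlgebra.exists_eq_star_mul_self_of_nonneg hM
    -- Writing `M = N⋆N`, right multiplication of the entries of `N` by `d` gives a square root of
    -- the conjugated matrix.
    let P : CStarMatrix (Fin k) (Fin k) A := N.map fun x => x * d
    suffices h : (star N * N).map (fun x => star d * x * d) = star P * P by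
      change 0 ≤ (star N * N).map (fun x => star d * x * d)
      rw [h]
      exact star_mul_self_nonneg P
    ext i j
    simp only [CStarMatrix.map_apply, CStarMatrix.mul_apply, CStarMatrix.star_apply, P,
      Finset.mul_sum, Finset.sum_mul, star_mul, mul_assoc]

/-- A linear map whose composition with an injective ⋆-homomorphism is completely positive is
completely positive. -/
def CompletelyPositiveMap.ofComp (f : A →ₗ[ℂ] B) (g : B →⋆ₙₐ[ℂ] C) (hg : Function.Injective g)
    (h : A →CP C) (hh : ∀ a, h a = g (f a)) : A →CP B where
  toLinearMap := f
  map_cstarMatrix_nonneg' k M hM := by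
    refine CStarMatrix.nonneg_of_map_nonneg g hg ?_
    have := h.map_cstarMatrix_nonneg' k M hM
    convert this using 1
    ext i j
    exact (hh _).symm

end CompletelyPositive

/-- A star-ordering is determined by the ring structure, its positive elements being generated by
the `s⋆s`. Nuclearity may therefore be tested in any given star-ordering. -/
lemma StarOrderedRing.eq_spectralOrder (A : Type*) [NonUnitalCStarAlgebra A] [o : PartialOrder A]
    [StarOrderedRing A] : o = CStarAlgebra.spectralOrder A := by
  have h := CStarAlgebra.spectralOrderedRing A
  refine PartialOrder.ext fun x y => ?_
  rw [StarOrderedRing.le_iff (R := A) x y]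
  exact ((@StarOrderedRing.le_iff A _ (CStarAlgebra.spectralOrder A) _ h x y)).symm

/-- Nuclearity, with respect to a given star-ordering. -/
lemma isNuclearCStar_iff {A : Type*} [NonUnitalCStarAlgebra A] [PartialOrder A]
    [StarOrderedRing A] : IsNuclearCStar A ↔ ∀ (F : Finset A) (ε : ℝ), 0 < ε →
      ∃ (n : ℕ) (φ : A →CP CStarMatrix (Fin n) (Fin n) ℂ)
        (ψ : CStarMatrix (Fin n) (Fin n) ℂ →CP A),
        (∀ a, ‖φ a‖ ≤ ‖a‖) ∧ (∀ x, ‖ψ x‖ ≤ ‖x‖) ∧ ∀ a ∈ F, ‖ψ (φ a) - a‖ < ε := by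
  obtain rfl := StarOrderedRing.eq_spectralOrder A
  rfl

/-- Nuclearity passes from `B` to `D` if the identity of `D` approximately factors through `B` by
completely positive contractions. -/
lemma IsNuclearCStar.of_approx {B D : Type*} [NonUnitalCStarAlgebra B] [NonUnitalCStarAlgebra D]
    [PartialOrder B] [PartialOrder D] [StarOrderedRing B] [StarOrderedRing D]
    (hB : IsNuclearCStar B)
    (h : ∀ (F : Finset D) (ε : ℝ), 0 < ε → ∃ (σ : D →CP B) (τ : B →CP D),
      (∀ a, ‖σ a‖ ≤ ‖a‖) ∧ (∀ x, ‖τ x‖ ≤ ‖x‖) ∧ ∀ a ∈ F, ‖τ (σ a) - a‖ < ε) :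
    IsNuclearCStar D := by
  classical
  rw [isNuclearCStar_iff] at hB ⊢
  intro F ε hε
  obtain ⟨σ, τ, hσ, hτ, h⟩ := h F (ε / 2) (by positivity)
  obtain ⟨n, φ, ψ, hφ, hψ, h'⟩ := hB (F.image σ) (ε / 2) (by positivity)
  refine ⟨n, φ.comp σ, τ.comp ψ, fun a => (hφ _).trans (hσ _), fun x => (hτ _).trans (hψ _),
    fun a ha => ?_⟩
  have h1 : ‖τ (ψ (φ (σ a)) - σ a)‖ < ε / 2 :=
    (hτ _).trans_lt (h' _ (Finset.mem_image_of_mem _ ha))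
  have h2 : τ (ψ (φ (σ a))) - a = τ (ψ (φ (σ a)) - σ a) + (τ (σ a) - a) := by
    rw [map_sub]; abel
  change ‖τ (ψ (φ (σ a))) - a‖ < ε
  rw [h2]
  exact (norm_add_le _ _).trans_lt (by linarith [h a ha])

/-! ## Unital purely infinite algebras -/

section PurelyInfinite

variable {A : Type*} [CStarAlgebra A]

/-- If `1` lies in `A c A` in one product then `z⋆ c⋆ c z = 1` for some `z`. -/
lemma exists_star_mul_mul_eq_one {c x y : A} (h : x * c * y = 1) :
    ∃ z : A, star z * (star c * c) * z = 1 := by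
  nontriviality A
  let _ : PartialOrder A := CStarAlgebra.spectralOrder A
  have : StarOrderedRing A := CStarAlgebra.spectralOrderedRing A
  set d := c * y with hd
  set k := star d * d with hk
  -- From `x d = 1` one gets `1 = d⋆(x⋆x)d ≤ ‖x⋆x‖ d⋆d`, so `k = d⋆d` is bounded below and
  -- `k^(-1/2)` exists; it normalises `y`.
  have h1 : (1 : A) ≤ ‖star x * x‖ • k := by
    have := CStarAlgebra.star_left_conjugate_le_norm_smul (a := d) (b := star x * x)
      (IsSelfAdjoint.star_mul_self x)
    have e : star d * (star x * x) * d = 1 := by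
      have h' : x * d = 1 := by rw [hd, ← mul_assoc, h]
      have : star (x * d) * (x * d) = 1 := by rw [h']; simp
      simpa only [star_mul, mul_assoc] using this
    rwa [e] at this
  have hpos : 0 < ‖star x * x‖ := by
    rcases (norm_nonneg (star x * x)).eq_or_lt with h0 | h0
    · rw [← h0, zero_smul] at h1
      exact absurd (le_antisymm h1 zero_le_one) one_ne_zero
    · exact h0
  have h2 : IsStrictlyPositive k := by
    have hu : IsUnit (‖star x * x‖ • k) := CStarAlgebra.isUnit_of_le 1 h1
    refine ⟨star_mul_self_nonneg d, ?_⟩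
    have := hu.smul (Units.mk0 _ hpos.ne')⁻¹
    simpa [Units.smul_def, smul_smul, hpos.ne'] using this
  have h3 := CFC.conjugate_rpow_neg_one_half k h2
  set r := k ^ (-(1 / 2) : ℝ)
  have hr : star r = r := (IsSelfAdjoint.of_nonneg CFC.rpow_nonneg).star_eq
  refine ⟨y * r, ?_⟩
  rw [← h3, hk, hd]
  simp only [star_mul, hr, mul_assoc]

variable [Nontrivial A]

/-- The Gelfand--Mazur theorem for C⋆-algebras. -/
lemma exists_not_isUnit_of_isEmpty_starAlgEquiv (h : IsEmpty (A ≃⋆ₐ[ℂ] ℂ)) :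
    ∃ a : A, a ≠ 0 ∧ ¬ IsUnit a := by
  by_contra! hc
  have hu : ∀ {a : A}, IsUnit a ↔ a ≠ 0 := fun {a} => ⟨fun h => h.ne_zero, hc a⟩
  let e := NormedRing.algEquivComplexOfComplete hu
  refine h.false (StarAlgEquiv.ofAlgEquiv e (fun z => ?_)).symm
  change algebraMap ℂ A (star z) = star (algebraMap ℂ A z)
  exact algebraMap_star_comm z

/-- A purely infinite unital C⋆-algebra contains two isometries with orthogonal ranges. -/
lemma exists_orthogonal_isometries (h : IsEmpty (A ≃⋆ₐ[ℂ] ℂ))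
    (hA : ∀ a : A, a ≠ 0 → ∃ x y, x * a * y = 1) :
    ∃ s t : A, star s * s = 1 ∧ star t * t = 1 ∧ star s * t = 0 := by
  obtain ⟨a, ha, hau⟩ := exists_not_isUnit_of_isEmpty_starAlgEquiv h
  obtain ⟨x, y, hxy⟩ := hA a ha
  -- Since `x a y = 1`, both `a y x` and `y x a` are nonzero idempotents. If both were `1`, then `a`
  -- would be invertible.
  obtain ⟨e, he, he0, he1⟩ : ∃ e : A, e * e = e ∧ e ≠ 0 ∧ 1 - e ≠ 0 := by
    by_contra! hc
    have h1 : a * (y * x) = 1 := by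
      refine (sub_eq_zero.mp (hc (a * (y * x)) ?_ ?_)).symm
      · calc a * (y * x) * (a * (y * x)) = a * y * (x * a * y) * x := by noncomm_ring
          _ = a * (y * x) := by rw [hxy]; noncomm_ring
      · intro h0
        have : x * (a * (y * x)) * (a * y) = x * a * y * (x * a * y) := by noncomm_ring
        rw [h0, hxy] at this
        simp at this
    have h2 : y * x * a = 1 := by
      refine (sub_eq_zero.mp (hc (y * x * a) ?_ ?_)).symm
      · calc y * x * a * (y * x * a) = y * (x * a * y) * x * a := by noncomm_ring
          _ = y * x * a := by rw [hxy]; noncomm_ring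
      · intro h0
        have : x * a * (y * x * a) * y = x * a * y * (x * a * y) := by noncomm_ring
        rw [h0, hxy] at this
        simp at this
    exact hau ⟨⟨a, y * x, h1, h2⟩, rfl⟩
  obtain ⟨_, _, h1⟩ := hA e he0
  obtain ⟨_, _, h2⟩ := hA (star (1 - e)) (star_ne_zero.mpr he1)
  obtain ⟨z, hz⟩ := exists_star_mul_mul_eq_one h1
  obtain ⟨w, hw⟩ := exists_star_mul_mul_eq_one h2
  -- The idempotent `e` need not be self-adjoint; the adjoint of `1 - e` is used because `e⋆(1 - e)⋆
  -- = ((1 - e)e)⋆ = 0`.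
  refine ⟨e * z, star (1 - e) * w, ?_, ?_, ?_⟩
  · simpa only [star_mul, mul_assoc] using hz
  · simpa only [star_mul, mul_assoc] using hw
  · have : star e * star (1 - e) = 0 := by
      rw [← star_mul, sub_mul, one_mul, he, sub_self, star_zero]
    rw [star_mul, mul_assoc, ← mul_assoc (star e), this, zero_mul, mul_zero]

/-- A purely infinite unital C⋆-algebra contains a sequence of isometries with orthogonal
ranges. -/
lemma exists_seq_orthogonal_isometries (h : IsEmpty (A ≃⋆ₐ[ℂ] ℂ))
    (hA : ∀ a : A, a ≠ 0 → ∃ x y, x * a * y = 1) :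
    ∃ s : ℕ → A, ∀ m n, star (s m) * s n = if m = n then 1 else 0 := by
  obtain ⟨s, t, hs, ht, hst⟩ := exists_orthogonal_isometries h hA
  have hts : star t * s = 0 := by rw [← star_star s, ← star_mul, hst, star_zero]
  have hpow : ∀ n, star (t ^ n) * t ^ n = 1 := by
    intro n
    induction n with
    | zero => simp
    | succ n ih =>
      rw [pow_succ', star_mul, mul_assoc, ← mul_assoc (star t), ht, one_mul, ih]
  have key : ∀ m k, star s * (star (t ^ m) * (t ^ (m + k) * s)) = if k = 0 then 1 else 0 := by
    intro m k
    rw [pow_add, mul_assoc, ← mul_assoc (star (t ^ m)), hpow, one_mul]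
    rcases k with _ | k
    · simp [hs]
    · rw [pow_succ', mul_assoc, ← mul_assoc, hst]; simp
  -- The isometries `tⁿ s` have orthogonal ranges: cancelling the common powers of `t` leaves `s⋆ t
  -- = 0`.
  refine ⟨fun n => t ^ n * s, fun m n => ?_⟩
  rcases le_total m n with hmn | hmn
  · obtain ⟨k, rfl⟩ := Nat.exists_eq_add_of_le hmn
    simpa [mul_assoc] using key m k
  · obtain ⟨k, rfl⟩ := Nat.exists_eq_add_of_le hmn
    have := congrArg star (key n k)
    rw [apply_ite star, star_one, star_zero] at this
    simpa [mul_assoc, eq_comm] using this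

end PurelyInfinite

/-- An algebra in which `x a y = b` can always be solved (for `a ≠ 0`) is simple. -/
lemma IsPurelyInfiniteSimple.of_exists {A : Type*} [NonUnitalCStarAlgebra A] (hn : Nontrivial A)
    (hc : IsEmpty (A ≃⋆ₐ[ℂ] ℂ)) (h : ∀ a b : A, a ≠ 0 → ∃ x y : A, x * a * y = b) :
    IsPurelyInfiniteSimple A where
  simple := ⟨hn, fun I _ => by
    by_cases hI : ∃ a ∈ I, a ≠ 0
    · obtain ⟨a, ha, ha0⟩ := hI
      right
      rw [eq_top_iff]
      intro b _
      obtain ⟨x, y, rfl⟩ := h a b ha0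
      exact I.mul_mem_right _ _ (I.mul_mem_left _ _ ha)
    · left
      rw [eq_bot_iff]
      intro a ha
      by_contra h0
      exact hI ⟨a, ha, fun h => h0 (by rw [h]; exact TwoSidedIdeal.zero_mem _)⟩⟩
  not_complex := hc
  exists_mul_mul_eq := h

/-! ## Stabilizations -/

/-- Data exhibiting the C⋆-algebra `C` as the stabilization of the unital C⋆-algebra `B`: matrix
corners `ι i j : B → C` that multiply like `b ⊗ e i j` and span a dense subspace. -/
structure StabilizationData (B C : Type*) [CStarAlgebra B] [NonUnitalCStarAlgebra C] where
  ι : ℤ → ℤ → B →ₗ[ℂ] C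
  mul_same : ∀ i j k a b, ι i j a * ι j k b = ι i k (a * b)
  mul_ne : ∀ i j j' k a b, j ≠ j' → ι i j a * ι j' k b = 0
  star_ι : ∀ i j a, star (ι i j a) = ι j i (star a)
  injective_zero : Function.Injective (ι 0 0)
  dense_span : (Submodule.span ℂ (⋃ i, ⋃ j, Set.range (ι i j))).topologicalClosure = ⊤

namespace StabilizationData

variable {B C : Type*} [CStarAlgebra B] [NonUnitalCStarAlgebra C] (S : StabilizationData B C)

/-- The diagonal embeddings as ⋆-homomorphisms. -/
def diag (i : ℤ) : B →⋆ₙₐ[ℂ] C where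
  toFun := S.ι i i
  map_smul' := map_smul _
  map_zero' := map_zero _
  map_add' := map_add _
  map_mul' a b := (S.mul_same i i i a b).symm
  map_star' a := (S.star_ι i i a).symm

/-- Multiplication by matrix units moves any diagonal corner to position `(0, 0)`, so injectivity
has to be postulated only there. -/
lemma diag_injective (i : ℤ) : Function.Injective (S.diag i) := by
  intro a b hab
  apply S.injective_zero
  have h : ∀ a, S.ι 0 0 a = S.ι 0 i 1 * S.diag i a * S.ι i 0 1 := by
    intro a
    change _ = S.ι 0 i 1 * S.ι i i a * S.ι i 0 1
    rw [S.mul_same, S.mul_same, one_mul, mul_one]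
  rw [h, h, hab]

/-- The C⋆-identity reduces to a diagonal corner, where an injective ⋆-homomorphism is isometric. -/
lemma norm_ι (i j : ℤ) (b : B) : ‖S.ι i j b‖ = ‖b‖ := by
  have h : ‖S.ι i j b‖ * ‖S.ι i j b‖ = ‖b‖ * ‖b‖ := by
    rw [← CStarRing.norm_star_mul_self, S.star_ι, S.mul_same, ← CStarRing.norm_star_mul_self]
    exact NonUnitalStarAlgHom.norm_map (S.diag j) (S.diag_injective j) _
  exact (mul_self_inj (norm_nonneg _) (norm_nonneg _)).mp h

lemma isometry_ι (i j : ℤ) : Isometry (S.ι i j) :=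
  AddMonoidHomClass.isometry_of_norm _ (S.norm_ι i j)

/-- The diagonal projection on a finite set of indices. -/
def proj (F : Finset ℤ) : C := ∑ i ∈ F, S.ι i i 1

lemma star_proj (F : Finset ℤ) : star (S.proj F) = S.proj F := by
  simp [proj, star_sum, S.star_ι]

lemma proj_mul_ι (F : Finset ℤ) (i j : ℤ) (b : B) :
    S.proj F * S.ι i j b = if i ∈ F then S.ι i j b else 0 := by
  rw [proj, Finset.sum_mul]
  split_ifs with h
  · rw [Finset.sum_eq_single_of_mem i h fun k _ hk => S.mul_ne _ _ _ _ _ _ hk, S.mul_same, one_mul]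
  · exact Finset.sum_eq_zero fun j hj => S.mul_ne _ _ _ _ _ _ fun e => h (e ▸ hj)

lemma proj_mul_proj (F G : Finset ℤ) : S.proj F * S.proj G = S.proj (F ∩ G) := by
  conv_lhs => rw [proj.eq_1 S G, Finset.mul_sum]
  simp only [proj_mul_ι]
  rw [Finset.sum_ite_mem, Finset.inter_comm, proj]

lemma norm_proj_le (F : Finset ℤ) : ‖S.proj F‖ ≤ 1 := by
  have h : ‖S.proj F‖ * ‖S.proj F‖ = ‖S.proj F‖ := by
    rw [← CStarRing.norm_star_mul_self, star_proj, proj_mul_proj, Finset.inter_self]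
  rcases (norm_nonneg (S.proj F)).eq_or_lt with h0 | h0
  · rw [← h0]; exact zero_le_one
  · exact (mul_right_cancel₀ h0.ne' (h.trans (one_mul _).symm)).le

/-- The diagonal projections form an approximate unit. -/
lemma tendsto_proj_mul (x : C) : Filter.Tendsto (fun F => S.proj F * x) Filter.atTop (nhds x) := by
  have hspan : ∀ y ∈ Submodule.span ℂ (⋃ i, ⋃ j, Set.range (S.ι i j)),
      Filter.Tendsto (fun F => S.proj F * y) Filter.atTop (nhds y) := by
    intro y hy
    induction hy using Submodule.span_induction with
    | mem y hy =>
      simp only [Set.mem_iUnion, Set.mem_range] at hy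
      obtain ⟨i, j, b, rfl⟩ := hy
      refine tendsto_const_nhds.congr' ?_
      filter_upwards [Filter.eventually_ge_atTop {i}] with F hF
      rw [proj_mul_ι, if_pos (hF (Finset.mem_singleton_self i))]
    | zero => simp
    | add y z _ _ hy hz => simpa only [mul_add] using hy.add hz
    | smul c y _ hy => simpa only [mul_smul_comm] using hy.const_smul c
  have hx : x ∈ closure (Submodule.span ℂ (⋃ i, ⋃ j, Set.range (S.ι i j)) : Set C) := by
    have : x ∈ (Submodule.span ℂ (⋃ i, ⋃ j, Set.range (S.ι i j))).topologicalClosure := by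
      rw [S.dense_span]; trivial
    exact this
  rw [Metric.tendsto_nhds]
  intro ε hε
  obtain ⟨y, hy, hxy⟩ := Metric.mem_closure_iff.mp hx (ε / 3) (by positivity)
  filter_upwards [Metric.tendsto_nhds.mp (hspan y hy) (ε / 3) (by positivity)] with F hF
  rw [dist_eq_norm] at *
  have h1 : S.proj F * x - x = S.proj F * (x - y) + (S.proj F * y - y) - (x - y) := by
    rw [mul_sub]; abel
  have h2 : ‖S.proj F * (x - y)‖ ≤ ‖x - y‖ :=
    (norm_mul_le _ _).trans (mul_le_of_le_one_left (norm_nonneg _) (S.norm_proj_le F))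
  rw [h1]
  have := norm_sub_le (S.proj F * (x - y) + (S.proj F * y - y)) (x - y)
  have := norm_add_le (S.proj F * (x - y)) (S.proj F * y - y)
  linarith

lemma tendsto_mul_proj (x : C) : Filter.Tendsto (fun F => x * S.proj F) Filter.atTop (nhds x) := by
  have := (S.tendsto_proj_mul (star x)).star
  simpa only [star_mul, star_star, star_proj] using this

/-- Corners of elements of `C` come from `B`. -/
lemma exists_corner_eq (i j : ℤ) (x : C) : ∃ b, S.ι i j b = S.ι i i 1 * x * S.ι j j 1 := by
  -- The range of the isometry `ι i j` is closed, so it suffices to treat the dense span.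
  have hcl : IsClosed {x : C | S.ι i i 1 * x * S.ι j j 1 ∈ Set.range (S.ι i j)} :=
    (S.isometry_ι i j).isClosedEmbedding.isClosed_range.preimage (by fun_prop)
  have hle : (Submodule.span ℂ (⋃ i, ⋃ j, Set.range (S.ι i j)) : Set C) ⊆
      {x : C | S.ι i i 1 * x * S.ι j j 1 ∈ Set.range (S.ι i j)} := by
    intro y hy
    change ∃ b, S.ι i j b = S.ι i i 1 * y * S.ι j j 1
    induction hy using Submodule.span_induction with
    | mem y hy =>
      simp only [Set.mem_iUnion, Set.mem_range] at hy
      obtain ⟨k, l, b, rfl⟩ := hy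
      by_cases hk : i = k
      · by_cases hl : l = j
        · subst hk hl
          exact ⟨b, by rw [S.mul_same, S.mul_same, one_mul, mul_one]⟩
        · subst hk
          exact ⟨0, by rw [S.mul_same, S.mul_ne _ _ _ _ _ _ hl, map_zero]⟩
      · exact ⟨0, by rw [S.mul_ne _ _ _ _ _ _ hk, zero_mul, map_zero]⟩
    | zero => exact ⟨0, by simp⟩
    | add y z _ _ hy hz =>
      obtain ⟨b, hb⟩ := hy
      obtain ⟨c, hc⟩ := hz
      exact ⟨b + c, by rw [map_add, hb, hc, mul_add, add_mul]⟩
    | smul c y _ hy =>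
      obtain ⟨b, hb⟩ := hy
      exact ⟨c • b, by rw [map_smul, hb, mul_smul_comm, smul_mul_assoc]⟩
  have hx : x ∈ (Submodule.span ℂ (⋃ i, ⋃ j, Set.range (S.ι i j))).topologicalClosure := by
    rw [S.dense_span]; trivial
  exact closure_minimal hle hcl hx

/-- An element annihilated by every diagonal unit is annihilated by the approximate unit, hence
zero. Apply this on the left, and then on the right by taking adjoints. -/
lemma exists_corner_ne_zero {x : C} (hx : x ≠ 0) : ∃ i j, S.ι i i 1 * x * S.ι j j 1 ≠ 0 := by
  have aux : ∀ y : C, (∀ i, S.ι i i 1 * y = 0) → y = 0 := by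
    intro y hy
    refine tendsto_nhds_unique (S.tendsto_proj_mul y) ?_
    have : (fun F => S.proj F * y) = fun _ => 0 := by
      funext F
      rw [proj, Finset.sum_mul]
      exact Finset.sum_eq_zero fun i _ => hy i
    rw [this]
    exact tendsto_const_nhds
  by_contra! h
  have h1 : ∀ j, x * S.ι j j 1 = 0 := fun j => aux _ fun i => by rw [← mul_assoc]; exact h i j
  refine hx (star_eq_zero.mp (aux _ fun i => ?_))
  rw [← star_star (S.ι i i 1), ← star_mul, S.star_ι, star_one, h1, star_zero]

/-! ### Rows of isometries, and factoring through one corner. -/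

/-- The elements `∑ (s i) ⊗ e 0 i`. -/
def row (s : ℤ → B) (F : Finset ℤ) : C := ∑ i ∈ F, S.ι 0 i (s i)

lemma star_row (s : ℤ → B) (F : Finset ℤ) :
    star (S.row s F) = ∑ i ∈ F, S.ι i 0 (star (s i)) := by
  simp only [row, star_sum, S.star_ι]

lemma ι_zero_mul_row (s : ℤ → B) (F : Finset ℤ) : S.ι 0 0 1 * S.row s F = S.row s F := by
  simp only [row, Finset.mul_sum, S.mul_same, one_mul]

lemma star_row_mul_row_of_orthogonal {s t : ℤ → B} (h : ∀ i j, star (s i) * t j = 0)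
    (F G : Finset ℤ) : star (S.row s F) * S.row t G = 0 := by
  rw [star_row, row, Finset.sum_mul_sum]
  exact Finset.sum_eq_zero fun i _ => Finset.sum_eq_zero fun j _ => by
    rw [S.mul_same, h, map_zero]

lemma star_row_mul_row {s : ℤ → B} (h : ∀ i j, star (s i) * s j = if i = j then 1 else 0)
    (F : Finset ℤ) : star (S.row s F) * S.row s F = S.proj F := by
  rw [star_row, row, Finset.sum_mul_sum, proj]
  refine Finset.sum_congr rfl fun i hi => ?_
  rw [Finset.sum_eq_single_of_mem i hi fun j _ hj => ?_, S.mul_same, h, if_pos rfl]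
  rw [S.mul_same, h, if_neg hj.symm, map_zero]

/-- A row of isometries is a partial isometry with initial projection `proj F`; Cauchy estimates for
rows thus become Cauchy estimates for the approximate unit. -/
lemma norm_row_mul {s : ℤ → B} (h : ∀ i j, star (s i) * s j = if i = j then 1 else 0)
    (F : Finset ℤ) (x : C) : ‖S.row s F * x‖ = ‖S.proj F * x‖ := by
  rw [← mul_self_inj (norm_nonneg _) (norm_nonneg _), ← CStarRing.norm_star_mul_self,
    ← CStarRing.norm_star_mul_self]
  congr 1
  have h1 : S.proj F * S.proj F = S.proj F := by rw [proj_mul_proj, Finset.inter_self]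
  rw [star_mul, star_mul, star_proj, mul_assoc, mul_assoc, ← mul_assoc _ (S.row s F),
    ← mul_assoc (S.proj F), star_row_mul_row S h, h1]

lemma norm_row_le {s : ℤ → B} (h : ∀ i j, star (s i) * s j = if i = j then 1 else 0)
    (F : Finset ℤ) : ‖S.row s F‖ ≤ 1 := by
  have h1 : ‖S.row s F‖ * ‖S.row s F‖ ≤ 1 := by
    rw [← CStarRing.norm_star_mul_self, star_row_mul_row S h]
    exact S.norm_proj_le F
  nlinarith [norm_nonneg (S.row s F)]

/-- The rows of isometries converge strictly. -/
lemma exists_tendsto_row_mul {s : ℤ → B} (h : ∀ i j, star (s i) * s j = if i = j then 1 else 0)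
    (x : C) : ∃ y, Filter.Tendsto (fun F => S.row s F * x) Filter.atTop (nhds y) := by
  have hs : Summable fun i => S.ι 0 i (s i) * x := by
    rw [summable_iff_vanishing_norm]
    intro ε hε
    obtain ⟨F, hF⟩ := (Metric.tendsto_nhds.mp (S.tendsto_proj_mul x) ε hε).exists
    refine ⟨F, fun t ht => ?_⟩
    rw [← Finset.sum_mul]
    change ‖S.row s t * x‖ < ε
    rw [norm_row_mul S h]
    -- A set `t` disjoint from `F` does not see `proj F * x`, so the tail is controlled by the error
    -- of the approximate unit at `F`.
    have h1 : S.proj t * x = S.proj t * (x - S.proj F * x) := by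
      rw [mul_sub, ← mul_assoc, proj_mul_proj, Finset.disjoint_iff_inter_eq_empty.mp ht]
      simp [proj]
    rw [h1]
    rw [dist_comm, dist_eq_norm] at hF
    exact ((norm_mul_le _ _).trans
      (mul_le_of_le_one_left (norm_nonneg _) (S.norm_proj_le t))).trans_lt hF
  obtain ⟨y, hy⟩ := hs
  refine ⟨y, ?_⟩
  simpa only [HasSum, SummationFilter.unconditional_filter, ← Finset.sum_mul, row] using hy

/-- If `B` contains infinitely many isometries with orthogonal ranges then every element of `C`
factors through the corner `B ⊗ e 0 0`. -/
lemma exists_mul_ι_zero_mul_eq {s : ℕ → B}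
    (hs : ∀ m n, star (s m) * s n = if m = n then 1 else 0) (c : C) :
    ∃ x y, x * S.ι 0 0 1 * y = c := by
  let _ : PartialOrder C := CStarAlgebra.spectralOrder C
  have : StarOrderedRing C := CStarAlgebra.spectralOrderedRing C
  obtain ⟨p, hp, -, hc⟩ := CStarAlgebra.exists_sum_four_nonneg c
  choose q hq using fun k => CStarAlgebra.exists_eq_star_mul_self_of_nonneg (hp k)
  -- Injectivity of the encoding splits one sequence of isometries into four mutually orthogonal
  -- families, one for each positive summand of `c`. The limits `y k` then satisfy `(y k)⋆ y k = p
  -- k` and `(y k)⋆ y l = 0` for `k ≠ l`.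
  let r : Fin 4 → ℤ → B := fun k i => s (Encodable.encode (k, i))
  have hr : ∀ k i j, star (r k i) * r k j = if i = j then 1 else 0 := by
    intro k i j
    rw [hs]
    simp
  have hr' : ∀ k l, k ≠ l → ∀ i j, star (r k i) * r l j = 0 := by
    intro k l hkl i j
    rw [hs, if_neg]
    simp [hkl]
  choose y hy using fun k => S.exists_tendsto_row_mul (hr k) (q k)
  have h0 : ∀ k, S.ι 0 0 1 * y k = y k := by
    intro k
    refine tendsto_nhds_unique ((hy k).const_mul (S.ι 0 0 1)) ?_
    simpa only [← mul_assoc, ι_zero_mul_row] using hy k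
  have h1 : ∀ k, star (y k) * y k = p k := by
    intro k
    refine tendsto_nhds_unique ((hy k).star.mul (hy k)) ?_
    have : ∀ F, star (S.row (r k) F * q k) * (S.row (r k) F * q k) =
        star (q k) * (S.proj F * q k) := fun F => by
      rw [← S.star_row_mul_row (hr k), star_mul]; simp only [mul_assoc]
    simp only [this]
    rw [hq k]
    exact (S.tendsto_proj_mul (q k)).const_mul _
  have h2 : ∀ k l, k ≠ l → star (y k) * y l = 0 := by
    intro k l hkl
    refine tendsto_nhds_unique ((hy k).star.mul (hy l)) ?_
    have : ∀ F, star (S.row (r k) F * q k) * (S.row (r l) F * q l) = 0 := fun F => by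
      rw [star_mul, mul_assoc, ← mul_assoc (star (S.row (r k) F)),
        S.star_row_mul_row_of_orthogonal (hr' k l hkl), zero_mul, mul_zero]
    simp only [this]
    exact tendsto_const_nhds
  refine ⟨∑ k : Fin 4, Complex.I ^ (k : ℕ) • star (y k), ∑ k, y k, ?_⟩
  rw [mul_assoc, Finset.mul_sum]
  simp only [h0]
  rw [hc, Finset.sum_mul_sum]
  refine Finset.sum_congr rfl fun k _ => ?_
  rw [Finset.sum_eq_single_of_mem k (Finset.mem_univ k) fun l _ hl => ?_, smul_mul_assoc, h1]
  rw [smul_mul_assoc, h2 _ _ hl.symm, smul_zero]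

include S in
lemma separableSpace [TopologicalSpace.SeparableSpace B] : TopologicalSpace.SeparableSpace C := by
  have h1 : TopologicalSpace.IsSeparable (⋃ i, ⋃ j, Set.range (S.ι i j)) :=
    .iUnion fun i => .iUnion fun j =>
      TopologicalSpace.isSeparable_range (S.isometry_ι i j).continuous
  have h2 := (h1.span (R := ℂ)).closure
  rw [← Submodule.topologicalClosure_coe, S.dense_span] at h2
  exact TopologicalSpace.isSeparable_univ_iff.mp h2

/-! ### Nuclearity and pure infiniteness of the stabilization. -/

/-- The compression to the corner `B ⊗ e 0 0`. -/
def compress : C →ₗ[ℂ] B :=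
  (LinearEquiv.ofInjective (S.ι 0 0) S.injective_zero).symm.toLinearMap ∘ₗ
    LinearMap.codRestrict (LinearMap.range (S.ι 0 0))
      (LinearMap.mulRight ℂ (S.ι 0 0 1) ∘ₗ LinearMap.mulLeft ℂ (S.ι 0 0 1))
      (fun x => S.exists_corner_eq 0 0 x)

lemma ι_compress (x : C) : S.ι 0 0 (S.compress x) = S.ι 0 0 1 * x * S.ι 0 0 1 :=
  congrArg Subtype.val ((LinearEquiv.ofInjective (S.ι 0 0) S.injective_zero).apply_symm_apply _)

include S in
/-- The stabilization of a nuclear C⋆-algebra that contains infinitely many isometries with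
orthogonal ranges is nuclear. -/
lemma isNuclear (hB : IsNuclearCStar B) {s : ℕ → B}
    (hs : ∀ m n, star (s m) * s n = if m = n then 1 else 0) : IsNuclearCStar C := by
  let _ : PartialOrder C := CStarAlgebra.spectralOrder C
  have : StarOrderedRing C := CStarAlgebra.spectralOrderedRing C
  let _ : PartialOrder B := CStarAlgebra.spectralOrder B
  have : StarOrderedRing B := CStarAlgebra.spectralOrderedRing B
  refine hB.of_approx fun F ε hε => ?_
  have hev : ∀ x ∈ F, ∀ᶠ G in Filter.atTop, ‖S.proj G * x * S.proj G - x‖ < ε := by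
    intro x _
    have h1 : Filter.Tendsto (fun G => S.proj G * x * S.proj G) Filter.atTop (nhds x) := by
      have h2 : Filter.Tendsto (fun G => S.proj G * (x * S.proj G - x)) Filter.atTop (nhds 0) := by
        refine squeeze_zero_norm (fun G => ?_)
          (tendsto_iff_norm_sub_tendsto_zero.mp (S.tendsto_mul_proj x))
        exact (norm_mul_le _ _).trans (mul_le_of_le_one_left (norm_nonneg _) (S.norm_proj_le G))
      have := h2.add (S.tendsto_proj_mul x)
      simpa only [mul_sub, ← mul_assoc, sub_add_cancel, zero_add] using this
    simpa only [dist_eq_norm] using Metric.tendsto_nhds.mp h1 ε hε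
  obtain ⟨G, hG⟩ := ((Filter.eventually_all_finset F).mpr hev).exists
  have hr : ∀ i j : ℤ, star (s (Encodable.encode i)) * s (Encodable.encode j) =
      if i = j then 1 else 0 := by
    intro i j; rw [hs]; simp
  set T : C := S.row (fun i => s (Encodable.encode i)) G with hT
  have hTp : star T * T = S.proj G := S.star_row_mul_row hr G
  have hTn : ‖T‖ ≤ 1 := S.norm_row_le hr G
  have h0T : S.ι 0 0 1 * T = T := S.ι_zero_mul_row _ G
  have hT0 : star T * S.ι 0 0 1 = star T := by
    conv_rhs => rw [← h0T, star_mul, S.star_ι, star_one]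
  have hcontr : ∀ x : C, ‖T * x * star T‖ ≤ ‖x‖ := by
    intro x
    calc ‖T * x * star T‖ ≤ ‖T‖ * ‖x‖ * ‖star T‖ :=
          (norm_mul_le _ _).trans (by gcongr; exact norm_mul_le _ _)
      _ ≤ 1 * ‖x‖ * 1 := by rw [norm_star]; gcongr
      _ = ‖x‖ := by ring
  have hcontr' : ∀ x : C, ‖star T * x * T‖ ≤ ‖x‖ := by
    intro x
    calc ‖star T * x * T‖ ≤ ‖star T‖ * ‖x‖ * ‖T‖ :=
          (norm_mul_le _ _).trans (by gcongr; exact norm_mul_le _ _)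
      _ ≤ 1 * ‖x‖ * 1 := by rw [norm_star]; gcongr
      _ = ‖x‖ := by ring
  -- As `T` lies in row `0`, the element `T x T⋆` lies in the corner `B ⊗ e 0 0`. Conjugating back
  -- by `T` gives `proj G * x * proj G`, which is close to `x` on `F`.
  let f : C →ₗ[ℂ] B := S.compress ∘ₗ LinearMap.mulRight ℂ (star T) ∘ₗ LinearMap.mulLeft ℂ T
  have hf : ∀ x, S.ι 0 0 (f x) = T * x * star T := by
    intro x
    change S.ι 0 0 (S.compress (T * x * star T)) = _
    rw [ι_compress, ← mul_assoc, ← mul_assoc, h0T, mul_assoc, hT0]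
  let σ : C →CP B := CompletelyPositiveMap.ofComp f (S.diag 0) (S.diag_injective 0)
    (CompletelyPositiveMap.conj (star T)) fun x => by
      change star (star T) * x * star T = S.ι 0 0 (f x)
      rw [hf, star_star]
  let τ : B →CP C := (CompletelyPositiveMap.conj T).comp
    (CompletelyPositiveMap.ofStarHom (S.diag 0))
  refine ⟨σ, τ, fun x => ?_, fun b => ?_, fun x hx => ?_⟩
  · change ‖f x‖ ≤ ‖x‖
    rw [← S.norm_ι 0 0, hf]
    exact hcontr x
  · change ‖star T * S.ι 0 0 b * T‖ ≤ ‖b‖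
    rw [← S.norm_ι 0 0 b]
    exact hcontr' _
  · change ‖star T * S.ι 0 0 (f x) * T - x‖ < ε
    rw [hf]
    convert hG x hx using 3
    rw [← hTp]
    simp only [mul_assoc]

include S in
/-- The stabilization of a unital Kirchberg algebra is a Kirchberg algebra. -/
theorem isKirchbergAlgebra (hB : IsKirchbergAlgebra B) : IsKirchbergAlgebra C := by
  have hnB : Nontrivial B := hB.purelyInfiniteSimple.simple.nontrivial
  obtain ⟨s, hs⟩ := exists_seq_orthogonal_isometries hB.purelyInfiniteSimple.not_complex
    fun a ha => hB.purelyInfiniteSimple.exists_mul_mul_eq a 1 ha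
  have hne : ∀ i, S.ι i i 1 ≠ 0 := fun i h =>
    one_ne_zero (S.diag_injective i (h.trans (map_zero _).symm))
  have := hB.separable
  refine ⟨.of_exists ⟨⟨_, _, hne 0⟩⟩ ⟨fun e => ?_⟩ fun a b ha => ?_, S.separableSpace,
    S.isNuclear hB.nuclear hs⟩
  -- Two nonzero diagonal units with product zero cannot live in the field `ℂ`.
  · have h := congrArg e (S.mul_ne 0 0 1 1 1 1 (by norm_num))
    rw [map_mul, map_zero, mul_eq_zero] at h
    rcases h with h | h
    · exact hne 0 (e.injective (h.trans (map_zero e).symm))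
    · exact hne 1 (e.injective (h.trans (map_zero e).symm))
  -- A nonzero corner of `a` has the form `ι i j c`. Solving `x c y = 1` in `B` produces `ι 0 0 1`
  -- from `a`, and `b` factors through that.
  · obtain ⟨i, j, hij⟩ := S.exists_corner_ne_zero ha
    obtain ⟨c, hc⟩ := S.exists_corner_eq i j a
    have hc0 : c ≠ 0 := by
      rintro rfl
      exact hij (by rw [← hc, map_zero])
    obtain ⟨x, y, hxy⟩ := hB.purelyInfiniteSimple.exists_mul_mul_eq c 1 hc0
    obtain ⟨z, w, hzw⟩ := S.exists_mul_ι_zero_mul_eq hs b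
    refine ⟨z * S.ι 0 i x, S.ι j 0 y * w, ?_⟩
    have h1 : S.ι 0 i x * a * S.ι j 0 y = S.ι 0 0 1 := by
      have h2 : S.ι 0 i x * (S.ι i i 1 * a * S.ι j j 1) * S.ι j 0 y = S.ι 0 i x * a * S.ι j 0 y := by
        have e1 : S.ι 0 i x * S.ι i i 1 = S.ι 0 i x := by rw [S.mul_same, mul_one]
        have e2 : S.ι j j 1 * S.ι j 0 y = S.ι j 0 y := by rw [S.mul_same, one_mul]
        conv_rhs => rw [← e1, ← e2]
        simp only [mul_assoc]
      rw [← h2, ← hc, S.mul_same, S.mul_same, hxy]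
    rw [← hzw, ← h1]
    simp only [mul_assoc]

end StabilizationData

/-! ## Fourier analysis for circle actions -/

namespace CircleAction

instance : IsProbabilityMeasure haar := ⟨by
  have := Measure.haarMeasure_self (K₀ := (⊤ : TopologicalSpace.PositiveCompacts Circle))
  simpa [haar] using this⟩

/-- The characters of the circle group. -/
def character (n : ℤ) : C(Circle, ℂ) := ⟨fun ζ => ((ζ ^ n : Circle) : ℂ),
  continuous_subtype_val.comp (continuous_zpow n)⟩

lemma norm_character (n : ℤ) (ζ : Circle) : ‖character n ζ‖ = 1 := Circle.norm_coe _

lemma character_zero (ζ : Circle) : character 0 ζ = 1 := by simp [character]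

lemma character_add (m n : ℤ) (ζ : Circle) :
    character (m + n) ζ = character m ζ * character n ζ := by
  simp [character, zpow_add]

lemma character_mul (n : ℤ) (ζ η : Circle) :
    character n (ζ * η) = character n ζ * character n η := by
  simp [character, mul_zpow]

lemma character_neg_mul_self (n : ℤ) (ζ : Circle) : character (-n) ζ * character n ζ = 1 := by
  rw [← character_add, neg_add_cancel, character_zero]

lemma star_character (n : ℤ) (ζ : Circle) : star (character n ζ) = character (-n) ζ := by
  change (starRingEnd ℂ) ((ζ ^ n : Circle) : ℂ) = ((ζ ^ (-n) : Circle) : ℂ)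
  rw [← Circle.coe_inv_eq_conj, zpow_neg]

lemma character_inv (n : ℤ) (ζ : Circle) : character n ζ⁻¹ = character (-n) ζ := by
  simp [character]

/-- Translating by `exp(iπ/n)`, where the character takes the value `-1`, changes the sign of the
integral. -/
lemma integral_character {n : ℤ} (hn : n ≠ 0) : ∫ ζ, character n ζ ∂haar = 0 := by
  have h1 : character n (Circle.exp (Real.pi / n)) = -1 := by
    have : (Circle.exp (Real.pi / n)) ^ n = Circle.exp Real.pi := by
      rw [← Circle.exp_zsmul]
      congr 1
      rw [zsmul_eq_mul]
      field_simp
    change ((_ ^ n : Circle) : ℂ) = -1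
    rw [this, Circle.coe_exp, Complex.exp_pi_mul_I]
  have h2 := integral_mul_left_eq_self (μ := haar) (fun ζ => character n ζ)
    (Circle.exp (Real.pi / n))
  simp only [character_mul, h1] at h2
  rw [integral_const_mul] at h2
  linear_combination (-1 / 2) * h2

/-- A continuous function on the circle all of whose Fourier coefficients vanish is zero. -/
lemma eq_zero_of_integral_character_mul (h : C(Circle, ℂ))
    (hh : ∀ n, ∫ ζ, character n ζ * h ζ ∂haar = 0) : h = 0 := by
  have hT : Fact (0 < 2 * Real.pi) := ⟨by positivity⟩
  let L : C(AddCircle (2 * Real.pi), ℂ) →ₗ[ℂ] ℂ :=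
    { toFun g := ∫ ζ, g (AddCircle.homeomorphCircle'.symm ζ) * h ζ ∂haar
      map_add' g g' := by
        simp only [ContinuousMap.add_apply, add_mul]
        exact integral_add (integrable_haar (by fun_prop)) (integrable_haar (by fun_prop))
      map_smul' c g := by
        simp only [ContinuousMap.smul_apply, smul_mul_assoc]
        exact integral_smul _ _ }
  have hL : Continuous L := by
    refine AddMonoidHomClass.continuous_of_bound L ‖h‖ fun g => ?_
    have : ∀ ζ, ‖g (AddCircle.homeomorphCircle'.symm ζ) * h ζ‖ ≤ ‖h‖ * ‖g‖ := fun ζ => by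
      rw [norm_mul, mul_comm]
      gcongr
      · exact h.norm_coe_le_norm ζ
      · exact g.norm_coe_le_norm _
    have := norm_integral_le_of_norm_le_const (μ := haar) (Filter.Eventually.of_forall this)
    rwa [probReal_univ, mul_one] at this
  have hfour : ∀ n (ζ : Circle),
      fourier n (AddCircle.homeomorphCircle'.symm ζ) = character n ζ := by
    intro n ζ
    obtain ⟨x, rfl⟩ := AddCircle.homeomorphCircle'.surjective ζ
    rw [Homeomorph.symm_apply_apply, fourier_apply]
    induction x using QuotientAddGroup.induction_on with
    | H x =>
    change _ = ((_ ^ n : Circle) : ℂ)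
    rw [AddCircle.homeomorphCircle'_apply_mk, ← QuotientAddGroup.mk_zsmul,
      AddCircle.toCircle_apply_mk, ← Circle.exp_zsmul]
    congr 2
    have : (2 * Real.pi) ≠ 0 := by positivity
    field_simp
  have hL0 : ∀ g, L g = 0 := by
    intro g
    have hg : g ∈ (Submodule.span ℂ (Set.range (fourier (T := 2 * Real.pi)))).topologicalClosure :=
      by rw [span_fourier_closure_eq_top]; trivial
    have hcl : IsClosed {g | L g = 0} := isClosed_eq hL continuous_const
    refine closure_minimal (fun g hg => ?_) hcl hg
    change L g = 0
    induction hg using Submodule.span_induction with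
    | mem g hg =>
      obtain ⟨n, rfl⟩ := hg
      change ∫ ζ, _ ∂haar = 0
      simp only [hfour, hh]
    | zero => exact map_zero L
    | add x y _ _ hx hy => rw [map_add, hx, hy, add_zero]
    | smul c x _ hx => rw [map_smul, hx, smul_zero]
  -- By density of the characters, `h` may be tested against its own conjugate, which gives `∫ |h|²
  -- = 0`.
  have h1 := hL0 ((star h).comp
    (AddCircle.homeomorphCircle' : C(AddCircle (2 * Real.pi), Circle)))
  change ∫ ζ, star (h (AddCircle.homeomorphCircle' (AddCircle.homeomorphCircle'.symm ζ))) * h ζ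
    ∂haar = 0 at h1
  simp only [Homeomorph.apply_symm_apply] at h1
  have h2 : ∀ ζ, star (h ζ) * h ζ = ((‖h ζ‖ ^ 2 : ℝ) : ℂ) := fun ζ => by
    rw [mul_comm]; simpa using Complex.mul_conj' (h ζ)
  simp only [h2] at h1
  rw [integral_complex_ofReal, Complex.ofReal_eq_zero] at h1
  have hc : Continuous fun ζ => ‖h ζ‖ ^ 2 := by fun_prop
  have hi : Integrable (fun ζ => ‖h ζ‖ ^ 2) haar :=
    hc.integrable_of_hasCompactSupport (HasCompactSupport.of_compactSpace _)
  rw [integral_eq_zero_iff_of_nonneg (fun _ => by positivity) hi] at h1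
  have h3 := (Continuous.ae_eq_iff_eq haar hc continuous_const).mp h1
  ext ζ
  have h4 : ‖h ζ‖ ^ 2 = 0 := congrFun h3 ζ
  simpa using h4

/-- A continuous function on the circle lies in a closed subspace as soon as its Fourier
coefficients do. -/
lemma mem_of_integral_character_smul_mem {X : Type*} [NormedAddCommGroup X] [NormedSpace ℂ X]
    [CompleteSpace X] (M : Submodule ℂ X) (hM : IsClosed (M : Set X)) {τ : Circle → X}
    (hτ : Continuous τ) (h : ∀ n, ∫ ζ, character n ζ • τ ζ ∂haar ∈ M) (ζ : Circle) :
    τ ζ ∈ M := by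
  have := hM
  -- Hahn–Banach in the quotient by `M`: a functional vanishing on `M`, composed with `τ`, is a
  -- scalar function whose Fourier coefficients all vanish.
  rw [← Submodule.Quotient.mk_eq_zero]
  refine SeparatingDual.eq_zero_of_forall_dual_eq_zero (R := ℂ) fun φ => ?_
  let ψ : X →L[ℂ] ℂ := φ.comp ⟨M.mkQ, continuous_quot_mk⟩
  have h0 := eq_zero_of_integral_character_mul ⟨fun ζ => ψ (τ ζ), by fun_prop⟩ fun n => by
    have hc : Continuous fun ζ => character n ζ • τ ζ := by fun_prop
    have h1 := ψ.integral_comp_comm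
      (hc.integrable_of_hasCompactSupport (μ := haar) (HasCompactSupport.of_compactSpace _))
    simp only [map_smul, smul_eq_mul] at h1
    refine h1.trans ?_
    change φ (Submodule.Quotient.mk _) = 0
    rw [(Submodule.Quotient.mk_eq_zero M).mpr (h n), map_zero]
  exact congrArg (fun f : C(Circle, ℂ) => f ζ) h0

/-! ### Spectral subspaces and Fourier coefficients. -/

variable {A : Type*} [CStarAlgebra A] (α : CircleAction A)

/-- The spectral subspaces of a circle action. -/
def spectralSubspace (n : ℤ) : Submodule ℂ A where
  carrier := {a | ∀ ζ : Circle, α ζ a = character n ζ • a}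
  zero_mem' ζ := by simp
  add_mem' ha hb ζ := by rw [map_add, ha ζ, hb ζ, smul_add]
  smul_mem' c a ha ζ := by rw [map_smul, ha ζ, smul_comm]

variable {α}

lemma mul_mem_spectralSubspace {m n : ℤ} {a b : A} (ha : a ∈ α.spectralSubspace m)
    (hb : b ∈ α.spectralSubspace n) : a * b ∈ α.spectralSubspace (m + n) := fun ζ => by
  rw [map_mul, ha ζ, hb ζ, smul_mul_smul_comm, character_add]

lemma star_mem_spectralSubspace {m : ℤ} {a : A} (ha : a ∈ α.spectralSubspace m) :
    star a ∈ α.spectralSubspace (-m) := fun ζ => by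
  rw [map_star, ha ζ, star_smul, star_character]

lemma mem_spectralSubspace_zero {a : A} :
    a ∈ α.spectralSubspace 0 ↔ a ∈ α.fixedPointAlgebra := by
  refine forall_congr' fun ζ => ?_
  rw [character_zero, one_smul]

lemma continuous_character_smul (n : ℤ) (a : A) :
    Continuous fun ζ => character n ζ • α ζ a :=
  (map_continuous _).smul (α.continuous_apply a)

variable (α) in
/-- The Fourier coefficients of an element with respect to a circle action. -/
def fourierCoeff (n : ℤ) : A →ₗ[ℂ] A where
  toFun a := ∫ ζ, character (-n) ζ • α ζ a ∂haar
  map_add' a b := by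
    simp only [map_add, smul_add]
    exact integral_add (integrable_haar (continuous_character_smul _ a))
      (integrable_haar (continuous_character_smul _ b))
  map_smul' c a := by
    simp only [map_smul, smul_comm _ c]
    exact integral_smul _ _

lemma fourierCoeff_apply (n : ℤ) (a : A) :
    α.fourierCoeff n a = ∫ ζ, character (-n) ζ • α ζ a ∂haar := rfl

lemma norm_fourierCoeff_le (n : ℤ) (a : A) : ‖α.fourierCoeff n a‖ ≤ ‖a‖ := by
  have : ∀ ζ, ‖character (-n) ζ • α ζ a‖ ≤ ‖a‖ := fun ζ => by
    rw [norm_smul, norm_character, one_mul, StarAlgEquiv.norm_map]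
  have := norm_integral_le_of_norm_le_const (μ := haar) (Filter.Eventually.of_forall this)
  rwa [probReal_univ, mul_one] at this

/-- Applying `α η` translates the integrand; invariance of Haar measure turns this into the factor
`ηⁿ`. -/
lemma fourierCoeff_mem (n : ℤ) (a : A) : α.fourierCoeff n a ∈ α.spectralSubspace n := by
  intro η
  rw [fourierCoeff_apply, act_integral α η (continuous_character_smul _ a), ← integral_smul,
    ← integral_mul_left_eq_self (fun ζ => character n η • character (-n) ζ • α ζ a) η]
  congr 1 with ζ
  rw [map_smul, act_act, character_mul, smul_smul, ← mul_assoc, mul_comm (character n η),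
    character_neg_mul_self, one_mul]

lemma fourierCoeff_of_mem {n : ℤ} {a : A} (ha : a ∈ α.spectralSubspace n) :
    α.fourierCoeff n a = a := by
  rw [fourierCoeff_apply]
  have : ∀ ζ, character (-n) ζ • α ζ a = a := fun ζ => by
    rw [ha ζ, smul_smul, character_neg_mul_self, one_smul]
  simp [this]

lemma fourierCoeff_of_mem_of_ne {m n : ℤ} (hmn : m ≠ n) {a : A}
    (ha : a ∈ α.spectralSubspace m) : α.fourierCoeff n a = 0 := by
  rw [fourierCoeff_apply]
  have : ∀ ζ, character (-n) ζ • α ζ a = character (-n + m) ζ • a := fun ζ => by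
    rw [ha ζ, smul_smul, character_add]
  simp only [this]
  rw [integral_smul_const, integral_character (by omega), zero_smul]

variable (α) in
/-- The spectral subspaces span a dense subspace. -/
lemma dense_span_spectralSubspace :
    (⨆ n, α.spectralSubspace n).topologicalClosure = ⊤ := by
  rw [eq_top_iff]
  intro a _
  -- The orbit map `ζ ↦ α ζ a` has all its Fourier coefficients in spectral subspaces, and its value
  -- at `1` is `a`.
  have := mem_of_integral_character_smul_mem _
    (Submodule.isClosed_topologicalClosure (⨆ n, α.spectralSubspace n))
    (α.continuous_apply a) (fun n => ?_) 1
  · rwa [show α.toHom 1 a = a from α.act_one a] at this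
  · apply Submodule.le_topologicalClosure
    have h := fourierCoeff_mem (α := α) (-n) a
    rw [fourierCoeff_apply, neg_neg] at h
    exact Submodule.mem_iSup_of_mem (-n) h

/-! ### Exactly equivariant unitaries. -/

/-- The Rokhlin property provides unitaries that are exactly equivariant. -/
lemma HasRokhlinProperty.exists_unitary [Nontrivial A] (hα : α.HasRokhlinProperty) {ε : ℝ}
    (hε : 0 < ε) (F : Finset A) :
    ∃ u ∈ unitary A, u ∈ α.spectralSubspace 1 ∧ ∀ a ∈ F, ‖u * a - a * u‖ < ε := by
  set K : ℝ := ∑ a ∈ F, ‖a‖ with hK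
  have hK0 : 0 ≤ K := Finset.sum_nonneg fun _ _ => norm_nonneg _
  -- The bound `1/8` keeps the spectrum of `w⋆w` within `1/4` of `1` and makes `5δ < 1`. The other
  -- bound absorbs the commutator error: `δ` from `v`, and `10δK` from `‖u - v‖ ≤ 5δ`.
  set δ : ℝ := min (1 / 8) (ε / (2 * (1 + 10 * K))) with hδ
  have hδ0 : 0 < δ := by positivity
  have hδ1 : δ ≤ 1 / 8 := min_le_left _ _
  have hδ2 : δ * (1 + 10 * K) < ε := by
    have : δ ≤ ε / (2 * (1 + 10 * K)) := min_le_right _ _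
    rw [le_div_iff₀ (by positivity)] at this
    nlinarith
  obtain ⟨v, hv, hv1, hv2⟩ := hα δ hδ0 F
  have hvn : ‖v‖ = 1 := CStarRing.norm_of_mem_unitary hv
  set w := α.fourierCoeff 1 v with hw
  have hwn : ‖w‖ ≤ 1 := (norm_fourierCoeff_le 1 v).trans hvn.le
  have hwm : w ∈ α.spectralSubspace 1 := fourierCoeff_mem 1 v
  have hwv : ‖w - v‖ ≤ δ := by
    have h1 : w - v = ∫ ζ, character (-1) ζ • (α ζ v - character 1 ζ • v) ∂haar := by
      simp only [smul_sub, smul_smul, character_neg_mul_self, one_smul]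
      rw [integral_sub (integrable_haar (continuous_character_smul _ v)) (integrable_const _)]
      simp [hw, fourierCoeff_apply]
    have h2 : ∀ ζ, ‖character (-1) ζ • (α ζ v - character 1 ζ • v)‖ ≤ δ := fun ζ => by
      rw [norm_smul, norm_character, one_mul]
      have := (hv1 ζ).le
      rwa [show character 1 ζ = (ζ : ℂ) by simp [character]]
    rw [h1]
    simpa using norm_integral_le_of_norm_le_const (μ := haar) (Filter.Eventually.of_forall h2)
  set h := star w * w with hh
  have hsa : IsSelfAdjoint h := .star_mul_self w
  have hh1 : ‖h - 1‖ ≤ 2 * δ := by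
    have e : h - 1 = star w * (w - v) + star (w - v) * v := by
      rw [mul_sub, star_sub, sub_mul, Unitary.star_mul_self_of_mem hv]; abel
    rw [e]
    refine (norm_add_le _ _).trans ?_
    have h1 := norm_mul_le (star w) (w - v)
    have h2 := norm_mul_le (star (w - v)) v
    rw [norm_star] at h1 h2
    nlinarith [norm_nonneg (w - v)]
  have hspec : ∀ x ∈ spectrum ℝ h, |x - 1| ≤ 2 * δ := by
    intro x hx
    have : x - 1 ∈ spectrum ℝ (h - 1) := by
      rw [← map_one (algebraMap ℝ A), ← spectrum.sub_singleton_eq]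
      exact ⟨x, hx, 1, rfl, rfl⟩
    exact (spectrum.norm_le_norm_of_mem this).trans hh1
  have hpos : ∀ x ∈ spectrum ℝ h, 3 / 4 ≤ x := by
    intro x hx
    have := abs_le.mp (hspec x hx)
    linarith
  let f : ℝ → ℝ := fun x => (√x)⁻¹
  have hf : ContinuousOn f (spectrum ℝ h) := by
    refine (Real.continuous_sqrt.continuousOn).inv₀ fun x hx => ?_
    have := hpos x hx
    exact (Real.sqrt_pos.mpr (by linarith)).ne'
  set r := cfc f h with hr
  have hrsa : IsSelfAdjoint r := cfc_predicate f h
  have hrhr : r * h * r = 1 := by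
    have e : r * h * r = cfc (fun x => f x * id x * f x) h := by
      rw [cfc_mul (fun x => f x * id x) f h (hf.mul continuousOn_id) hf,
        cfc_mul f id h hf continuousOn_id, cfc_id ℝ h]
    rw [e, ← cfc_one ℝ h]
    refine cfc_congr fun x hx => ?_
    have := hpos x hx
    have h0 : √x ≠ 0 := (Real.sqrt_pos.mpr (by linarith)).ne'
    simp only [f, id, Pi.one_apply]
    field_simp
    exact (Real.sq_sqrt (by linarith)).symm
  have hr1 : ‖r - 1‖ ≤ 4 * δ := by
    rw [hr, ← cfc_one ℝ h, ← cfc_sub f 1 h hf continuousOn_const]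
    refine norm_cfc_le (by positivity) fun x hx => ?_
    have h1 := hpos x hx
    have h2 := abs_le.mp (hspec x hx)
    have h3 : 1 / 2 ≤ √x := Real.le_sqrt_of_sq_le (by linarith)
    have h4 : √x * √x = x := Real.mul_self_sqrt (by linarith)
    simp only [f, Pi.one_apply, Real.norm_eq_abs]
    have h5 : (√x)⁻¹ - 1 = (1 - √x) / √x := by field_simp
    rw [h5, abs_div, abs_of_pos (by linarith : 0 < √x), div_le_iff₀ (by linarith), abs_le]
    constructor <;> nlinarith
  -- Polar decomposition: `r = (w⋆w)^(-1/2)`. It is fixed by the action because `w⋆w` is, so `u`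
  -- keeps the degree of `w`.
  set u := w * r with hu
  have hu1 : star u * u = 1 := by
    rw [hu, star_mul, hrsa.star_eq, ← hrhr, hh]; simp only [mul_assoc]
  have huv : ‖u - v‖ ≤ 5 * δ := by
    have e : u - v = w * (r - 1) + (w - v) := by rw [hu, mul_sub, mul_one]; abel
    rw [e]
    refine (norm_add_le _ _).trans ?_
    have := norm_mul_le w (r - 1)
    nlinarith [norm_nonneg (r - 1)]
  -- So far `u` is only an isometry; being within distance `5δ < 1` of the unitary `v` makes it
  -- invertible, hence unitary.
  have hunit : IsUnit u := by
    have h1 : ‖1 - star v * u‖ < 1 := by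
      have e : 1 - star v * u = -(star v * (u - v)) := by
        rw [mul_sub, Unitary.star_mul_self_of_mem hv]; abel
      rw [e, norm_neg]
      refine (norm_mul_le _ _).trans_lt ?_
      rw [norm_star, hvn, one_mul]
      linarith
    have h2 : IsUnit (star v * u) := by
      have := (Units.oneSub (1 - star v * u) h1).isUnit
      simpa using this
    have h3 : u = v * (star v * u) := by
      rw [← mul_assoc, Unitary.mul_star_self_of_mem hv, one_mul]
    rw [h3]
    exact (IsUnit.mul (Unitary.toUnits ⟨v, hv⟩).isUnit h2)
  refine ⟨u, ⟨hu1, ?_⟩, ?_, fun a ha => ?_⟩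
  · obtain ⟨U, hU⟩ := hunit
    have : star u = ↑U⁻¹ := by
      rw [← mul_one (star u), ← U.mul_inv, ← mul_assoc, hU, hu1, one_mul]
    rw [this, ← hU, U.mul_inv]
  · have hh0 : h ∈ α.spectralSubspace 0 := by
      have := mul_mem_spectralSubspace (star_mem_spectralSubspace hwm) hwm
      simpa using this
    have hr0 : r ∈ α.spectralSubspace 0 := by
      rw [mem_spectralSubspace_zero] at hh0 ⊢
      intro ζ
      have hcont : Continuous (α ζ) := (StarAlgEquiv.isometry (α ζ)).continuous
      have := StarAlgHomClass.map_cfc (R := ℝ) (S := ℂ) (α ζ) f h hf hcont hsa (hsa.map (α ζ))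
      rw [hr, this, hh0 ζ]
    have := mul_mem_spectralSubspace hwm hr0
    simpa using this
  · have haK : ‖a‖ ≤ K := Finset.single_le_sum (f := fun a => ‖a‖) (fun _ _ => norm_nonneg _) ha
    have e : u * a - a * u = (u - v) * a - a * (u - v) + (v * a - a * v) := by
      rw [sub_mul, mul_sub]; abel
    rw [e]
    have h1 := norm_add_le ((u - v) * a - a * (u - v)) (v * a - a * v)
    have h2 := norm_sub_le ((u - v) * a) (a * (u - v))
    have h3 := norm_mul_le (u - v) a
    have h4 := norm_mul_le a (u - v)
    have h5 := hv2 a ha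
    have h6 : ‖u - v‖ * ‖a‖ ≤ 5 * δ * K := by gcongr
    nlinarith

/-- The Rokhlin property provides an asymptotically central net of exactly equivariant unitaries. -/
lemma HasRokhlinProperty.exists_net [Nontrivial A] (hα : α.HasRokhlinProperty) :
    ∃ u : Finset A × ℕ → A, (∀ j, u j ∈ unitary A) ∧ (∀ j, u j ∈ α.spectralSubspace 1) ∧
      ∀ a, Filter.Tendsto (fun j => u j * a - a * u j) Filter.atTop (nhds 0) := by
  classical
  have hpos : ∀ n : ℕ, (0 : ℝ) < 1 / (n + 1) := fun n => by positivity
  choose u hu hu1 hu2 using fun j : Finset A × ℕ => hα.exists_unitary (hpos j.2) j.1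
  refine ⟨u, hu, hu1, fun a => ?_⟩
  rw [tendsto_zero_iff_norm_tendsto_zero]
  have h1 : Filter.Tendsto (fun j : Finset A × ℕ => (1 : ℝ) / (j.2 + 1)) Filter.atTop (nhds 0) := by
    rw [← Filter.prod_atTop_atTop_eq]
    exact tendsto_one_div_add_atTop_nhds_zero_nat.comp Filter.tendsto_snd
  refine squeeze_zero' (Filter.Eventually.of_forall fun _ => norm_nonneg _) ?_ h1
  filter_upwards [Filter.eventually_ge_atTop ({a}, 0)] with j hj
  exact (hu2 j a (hj.1 (Finset.mem_singleton_self a))).le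

end CircleAction

/-! ## Fixed point algebras of Rokhlin actions -/

namespace CircleAction

variable {A : Type*} [CStarAlgebra A] {α : CircleAction A}

/-! ### Asymptotic evaluation of trigonometric polynomials. -/

section NormControl

variable {J : Type*} {l : Filter J} {u : J → unitary A}

/-- Integer powers of an asymptotically central family of unitaries are asymptotically central. -/
lemma tendsto_zpow_commutator
    (hu : ∀ a : A, Filter.Tendsto (fun j => (u j : A) * a - a * u j) l (nhds 0)) (n : ℤ) (a : A) :
    Filter.Tendsto (fun j => ((u j ^ n : unitary A) : A) * a - a * (u j ^ n : unitary A)) l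
      (nhds 0) := by
  have hadd : ∀ v w : J → unitary A,
      Filter.Tendsto (fun j => (v j : A) * a - a * v j) l (nhds 0) →
      Filter.Tendsto (fun j => (w j : A) * a - a * w j) l (nhds 0) →
      Filter.Tendsto (fun j => ((v j * w j : unitary A) : A) * a - a * (v j * w j : unitary A)) l
        (nhds 0) := by
    intro v w hv hw
    refine squeeze_zero_norm (fun j => ?_) (by simpa using hv.norm.add hw.norm)
    have e : ((v j * w j : unitary A) : A) * a - a * (v j * w j : unitary A) =
        ((v j : A) * a - a * v j) * w j + v j * ((w j : A) * a - a * w j) := by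
      simp only [Submonoid.coe_mul]; noncomm_ring
    rw [e]
    refine (norm_add_le _ _).trans (le_of_eq ?_)
    rw [CStarRing.norm_mul_coe_unitary, CStarRing.norm_coe_unitary_mul]
  have hinv : Filter.Tendsto
      (fun j => (((u j)⁻¹ : unitary A) : A) * a - a * ((u j)⁻¹ : unitary A)) l (nhds 0) := by
    refine squeeze_zero_norm (fun j => ?_) (by simpa using (hu a).norm)
    have e : (((u j)⁻¹ : unitary A) : A) * a - a * ((u j)⁻¹ : unitary A) =
        -((((u j)⁻¹ : unitary A) : A) * ((u j : A) * a - a * u j) * ((u j)⁻¹ : unitary A)) := by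
      have h1 : (((u j)⁻¹ : unitary A) : A) * (u j : A) = 1 := Unitary.coe_star_mul_self (u j)
      have h2 : (u j : A) * (((u j)⁻¹ : unitary A) : A) = 1 := Unitary.coe_mul_star_self (u j)
      rw [mul_sub, sub_mul, ← mul_assoc, h1, one_mul, mul_assoc _ _ (((u j)⁻¹ : unitary A) : A),
        mul_assoc a, h2, mul_one, neg_sub]
    rw [e, norm_neg, CStarRing.norm_mul_coe_unitary, CStarRing.norm_coe_unitary_mul]
  induction n with
  | zero => simpa using tendsto_const_nhds
  | succ n ih =>
    simp only [zpow_add, zpow_one]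
    exact hadd _ _ ih (hu a)
  | pred n ih =>
    simp only [zpow_sub_one]
    exact hadd _ _ ih hinv

variable (α l u) in
/-- `IsEvaluation α l u N a x` says that `a` is a trigonometric polynomial `∑ c i` of degree at
most `N` and that `x` is asymptotically its evaluation `∑ c i * u ^ (-d i)` at `u⋆`. -/
def IsEvaluation (N : ℕ) (a : A) (x : J → A) : Prop :=
  ∃ (ι : Type) (_ : Fintype ι) (c : ι → A) (d : ι → ℤ), (∀ i, c i ∈ α.spectralSubspace (d i)) ∧
    (∀ i, |d i| ≤ N) ∧ a = ∑ i, c i ∧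
    Filter.Tendsto (fun j => x j - ∑ i, c i * (u j ^ (-d i) : unitary A)) l (nhds 0)

namespace IsEvaluation

lemma of_mem {n : ℤ} {a : A} (ha : a ∈ α.spectralSubspace n) :
    IsEvaluation α l u n.natAbs a fun j => a * (u j ^ (-n) : unitary A) :=
  ⟨Unit, inferInstance, fun _ => a, fun _ => n, fun _ => ha, fun _ => by simp, by simp,
    by simpa using tendsto_const_nhds⟩

lemma of_mem_zero {a : A} (ha : a ∈ α.spectralSubspace 0) :
    IsEvaluation α l u 0 a fun _ => a := by
  simpa using of_mem (l := l) (u := u) ha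

protected lemma add {M N : ℕ} {a b : A} {x y : J → A} (ha : IsEvaluation α l u M a x)
    (hb : IsEvaluation α l u N b y) :
    IsEvaluation α l u (M + N) (a + b) fun j => x j + y j := by
  obtain ⟨ι, _, c, d, hc, hd, rfl, hx⟩ := ha
  obtain ⟨κ, _, c', d', hc', hd', rfl, hy⟩ := hb
  refine ⟨ι ⊕ κ, inferInstance, Sum.elim c c', Sum.elim d d', ?_, ?_, by simp, ?_⟩
  · rintro (i | i)
    exacts [hc i, hc' i]
  · rintro (i | i)
    · simpa using (hd i).trans (by simp)
    · simpa using (hd' i).trans (by simp)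
  · have := hx.add hy
    rw [zero_add] at this
    refine this.congr fun j => ?_
    simp only [Fintype.sum_sum_type, Sum.elim_inl, Sum.elim_inr]
    abel

section

variable (hu : ∀ a : A, Filter.Tendsto (fun j => (u j : A) * a - a * u j) l (nhds 0))
include hu

protected lemma star {N : ℕ} {a : A} {x : J → A} (ha : IsEvaluation α l u N a x) :
    IsEvaluation α l u N (star a) fun j => star (x j) := by
  obtain ⟨ι, _, c, d, hc, hd, rfl, hx⟩ := ha
  refine ⟨ι, inferInstance, fun i => star (c i), fun i => -d i,
    fun i => star_mem_spectralSubspace (hc i), fun i => by rw [abs_neg]; exact hd i,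
    star_sum _ _, ?_⟩
  -- The adjoint of `c u^(-d)` is `u^d c⋆`, with the factors in the wrong order; asymptotic
  -- centrality corrects this.
  have h1 := tendsto_finsetSum (Finset.univ : Finset ι) fun i _ =>
    tendsto_zpow_commutator hu (d i) (star (c i))
  have := hx.star.add h1
  simp only [star_zero, Finset.sum_const_zero, add_zero] at this
  refine this.congr fun j => ?_
  have h2 : ∀ i, star ((u j ^ (-d i) : unitary A) : A) = ((u j ^ d i : unitary A) : A) := by
    intro i
    rw [← Unitary.coe_star, Unitary.star_eq_inv, zpow_neg, inv_inv]
  simp only [star_sub, star_sum, star_mul, h2, neg_neg, Finset.sum_sub_distrib]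
  abel

protected lemma mul {M N : ℕ} {a b : A} {x y : J → A} (ha : IsEvaluation α l u M a x)
    (hb : IsEvaluation α l u N b y) :
    IsEvaluation α l u (M + N) (a * b) fun j => x j * y j := by
  obtain ⟨ι, _, c, d, hc, hd, rfl, hx⟩ := ha
  obtain ⟨κ, _, c', d', hc', hd', rfl, hy⟩ := hb
  refine ⟨ι × κ, inferInstance, fun i => c i.1 * c' i.2, fun i => d i.1 + d' i.2,
    fun i => mul_mem_spectralSubspace (hc _) (hc' _), fun i => ?_, ?_, ?_⟩
  · push_cast
    exact (abs_add_le _ _).trans (add_le_add (hd _) (hd' _))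
  · rw [Finset.sum_mul_sum, Fintype.sum_prod_type]
  set X : J → A := fun j => ∑ i, c i * (u j ^ (-d i) : unitary A) with hX
  set Y : J → A := fun j => ∑ i, c' i * (u j ^ (-d' i) : unitary A) with hY
  have hXb : ∀ j, ‖X j‖ ≤ ∑ i, ‖c i‖ := fun j =>
    (norm_sum_le _ _).trans (Finset.sum_le_sum fun i _ => by rw [CStarRing.norm_mul_coe_unitary])
  have hYb : ∀ j, ‖Y j‖ ≤ ∑ i, ‖c' i‖ := fun j =>
    (norm_sum_le _ _).trans (Finset.sum_le_sum fun i _ => by rw [CStarRing.norm_mul_coe_unitary])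
  have h1 : Filter.Tendsto (fun j => (x j - X j) * (y j - Y j)) l (nhds 0) := by
    have := hx.mul hy
    rwa [mul_zero] at this
  have h2 : Filter.Tendsto (fun j => (x j - X j) * Y j) l (nhds 0) := by
    have h := hx.norm.mul_const (∑ i, ‖c' i‖)
    rw [norm_zero, zero_mul] at h
    refine squeeze_zero_norm (fun j => ?_) h
    exact (norm_mul_le _ _).trans (by gcongr; exact hYb j)
  have h3 : Filter.Tendsto (fun j => X j * (y j - Y j)) l (nhds 0) := by
    have h := hy.norm.const_mul (∑ i, ‖c i‖)
    rw [norm_zero, mul_zero] at h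
    refine squeeze_zero_norm (fun j => ?_) h
    exact (norm_mul_le _ _).trans (by gcongr; exact hXb j)
  -- This sum is the failure of exact multiplicativity: moving `u^(-d i)` past `c' k` costs one
  -- commutator per pair of terms.
  have h4 : Filter.Tendsto (fun j => ∑ i, ∑ k, c i * (((u j ^ (-d i) : unitary A) : A) * c' k -
      c' k * (u j ^ (-d i) : unitary A)) * (u j ^ (-d' k) : unitary A)) l (nhds 0) := by
    have : ∀ i k, Filter.Tendsto (fun j => c i * (((u j ^ (-d i) : unitary A) : A) * c' k -
        c' k * (u j ^ (-d i) : unitary A)) * (u j ^ (-d' k) : unitary A)) l (nhds 0) := by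
      intro i k
      have h := (tendsto_zpow_commutator hu (-d i) (c' k)).norm.const_mul ‖c i‖
      rw [norm_zero, mul_zero] at h
      refine squeeze_zero_norm (fun j => ?_) h
      rw [CStarRing.norm_mul_coe_unitary]
      exact norm_mul_le _ _
    simpa using tendsto_finsetSum (Finset.univ : Finset ι) fun i _ =>
      tendsto_finsetSum (Finset.univ : Finset κ) fun k _ => this i k
  have h5 := ((h1.add h2).add h3).add h4
  simp only [add_zero] at h5
  refine h5.congr fun j => ?_
  have e1 : ∑ i, ∑ k, c i * (((u j ^ (-d i) : unitary A) : A) * c' k -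
      c' k * (u j ^ (-d i) : unitary A)) * (u j ^ (-d' k) : unitary A) =
      X j * Y j - ∑ i : ι × κ, c i.1 * c' i.2 * (u j ^ (-(d i.1 + d' i.2)) : unitary A) := by
    rw [hX, hY, Fintype.sum_prod_type]
    simp only [Finset.sum_mul_sum, ← Finset.sum_sub_distrib]
    refine Finset.sum_congr rfl fun i _ => Finset.sum_congr rfl fun k _ => ?_
    rw [neg_add, zpow_add, Submonoid.coe_mul]
    noncomm_ring
  rw [e1]
  noncomm_ring

protected lemma pow {N : ℕ} {a : A} {x : J → A} (ha : IsEvaluation α l u N a x) (m : ℕ) :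
    IsEvaluation α l u (m * N) (a ^ m) fun j => x j ^ m := by
  induction m with
  | zero =>
    have h : (1 : A) ∈ α.spectralSubspace 0 := mem_spectralSubspace_zero.mpr (one_mem _)
    simpa using of_mem_zero h
  | succ m ih =>
    simp only [pow_succ, Nat.succ_mul]
    exact ih.mul hu ha

end

/-- The trivial norm bound for evaluations of trigonometric polynomials. -/
lemma eventually_norm_lt_of_degree_mul_lt {N : ℕ} {a : A} {x : J → A}
    (ha : IsEvaluation α l u N a x) {r : ℝ} (hr : (2 * N + 1) * ‖a‖ < r) :
    ∀ᶠ j in l, ‖x j‖ < r := by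
  obtain ⟨ι, _, c, d, hc, hd, rfl, hx⟩ := ha
  set a := ∑ i, c i with ha
  -- Several terms may share a degree. Once they are grouped, the coefficient of degree `n` is the
  -- Fourier coefficient of `a`, of norm at most `‖a‖`; there are `2N + 1` degrees.
  have h1 : ∀ j, ∑ i, c i * (u j ^ (-d i) : unitary A) =
      ∑ n ∈ Finset.Icc (-N : ℤ) N, α.fourierCoeff n a * (u j ^ (-n) : unitary A) := by
    intro j
    rw [← Finset.sum_fiberwise_of_maps_to (s := Finset.univ) (t := Finset.Icc (-N : ℤ) N) (g := d)
      fun i _ => Finset.mem_Icc.mpr (abs_le.mp (hd i))]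
    refine Finset.sum_congr rfl fun n _ => ?_
    have h2 : α.fourierCoeff n a = ∑ i with d i = n, c i := by
      rw [ha, map_sum, Finset.sum_filter]
      refine Finset.sum_congr rfl fun i _ => ?_
      split_ifs with h
      · exact fourierCoeff_of_mem (h ▸ hc i)
      · exact fourierCoeff_of_mem_of_ne h (hc i)
    rw [h2, Finset.sum_mul]
    refine Finset.sum_congr rfl fun i hi => ?_
    rw [(Finset.mem_filter.mp hi).2]
  have h2 : ∀ j, ‖∑ i, c i * (u j ^ (-d i) : unitary A)‖ ≤ (2 * N + 1) * ‖a‖ := by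
    intro j
    rw [h1]
    calc _ ≤ ∑ n ∈ Finset.Icc (-N : ℤ) N, ‖a‖ := (norm_sum_le _ _).trans
          (Finset.sum_le_sum fun n _ => by
            rw [CStarRing.norm_mul_coe_unitary]; exact norm_fourierCoeff_le n a)
      _ = (2 * N + 1) * ‖a‖ := by
        rw [Finset.sum_const, Int.card_Icc, nsmul_eq_mul,
          show ((N : ℤ) + 1 - -N).toNat = 2 * N + 1 by omega]
        push_cast; ring
  filter_upwards [Metric.tendsto_nhds.mp hx (r - (2 * N + 1) * ‖a‖) (by linarith)] with j hj
  rw [dist_zero_right] at hj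
  have := norm_add_le (x j - ∑ i, c i * (u j ^ (-d i) : unitary A))
    (∑ i, c i * (u j ^ (-d i) : unitary A))
  rw [sub_add_cancel] at this
  linarith [h2 j]

/-- Evaluation of trigonometric polynomials is asymptotically contractive: the trivial bound grows
polynomially in the degree, and so disappears upon passing to powers. -/
lemma eventually_norm_lt
    (hu : ∀ a : A, Filter.Tendsto (fun j => (u j : A) * a - a * u j) l (nhds 0))
    {N : ℕ} {a : A} {x : J → A} (ha : IsEvaluation α l u N a x) {r : ℝ} (hr : ‖a‖ < r) :
    ∀ᶠ j in l, ‖x j‖ < r := by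
  have hr0 : 0 < r := (norm_nonneg a).trans_lt hr
  have hb := (ha.star hu).mul hu ha
  set q : ℝ := (‖a‖ / r) ^ 2 with hq
  have hq0 : 0 ≤ q := by positivity
  have hq1 : q < 1 := by
    rw [hq, sq_lt_one_iff₀ (by positivity), div_lt_one hr0]; exact hr
  have hlim : Filter.Tendsto (fun m : ℕ => (2 * (m * (N + N) : ℕ) + 1 : ℝ) * q ^ m) Filter.atTop
      (nhds 0) := by
    have h1 := tendsto_pow_const_mul_const_pow_of_lt_one 1 hq0 hq1
    have h2 := tendsto_pow_atTop_nhds_zero_of_lt_one hq0 hq1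
    have := (h1.const_mul (4 * N : ℝ)).add h2
    simp only [mul_zero, add_zero] at this
    refine this.congr fun m => ?_
    push_cast; ring
  -- Exponents `2^k` are used since `‖h ^ 2^k‖ = ‖h‖ ^ 2^k` for self-adjoint `h`. The degree bound
  -- grows linearly in the exponent and loses against the geometric factor.
  have hpow : Filter.Tendsto (fun k : ℕ => 2 ^ k) Filter.atTop Filter.atTop :=
    tendsto_pow_atTop_atTop_of_one_lt (by norm_num)
  obtain ⟨k, hk⟩ := ((hlim.comp hpow).eventually (gt_mem_nhds zero_lt_one)).exists
  simp only [Function.comp_apply] at hk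
  have hbound : (2 * (2 ^ k * (N + N) : ℕ) + 1 : ℝ) * ‖(star a * a) ^ 2 ^ k‖ <
      (r ^ 2) ^ 2 ^ k := by
    have h1 : ‖(star a * a) ^ 2 ^ k‖ = (‖a‖ ^ 2) ^ 2 ^ k := by
      rw [(IsSelfAdjoint.star_mul_self a).norm_pow_two_pow, CStarRing.norm_star_mul_self, sq]
    have h2 : q ^ 2 ^ k = (‖a‖ ^ 2) ^ 2 ^ k / (r ^ 2) ^ 2 ^ k := by
      rw [hq, div_pow, div_pow]
    rw [h2, ← mul_div_assoc, div_lt_one (by positivity)] at hk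
    rwa [h1]
  filter_upwards [(hb.pow hu (2 ^ k)).eventually_norm_lt_of_degree_mul_lt hbound] with j hj
  rw [(IsSelfAdjoint.star_mul_self (x j)).norm_pow_two_pow, CStarRing.norm_star_mul_self,
    ← sq] at hj
  have h1 := lt_of_pow_lt_pow_left₀ _ (by positivity) hj
  exact lt_of_pow_lt_pow_left₀ 2 hr0.le h1

end IsEvaluation

lemma zpow_mem_spectralSubspace {v : unitary A} (hv : (v : A) ∈ α.spectralSubspace 1) (n : ℤ) :
    ((v ^ n : unitary A) : A) ∈ α.spectralSubspace n := by
  have hinv : (((v⁻¹ : unitary A)) : A) ∈ α.spectralSubspace (-1) :=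
    star_mem_spectralSubspace hv
  induction n with
  | zero =>
    rw [zpow_zero]
    exact mem_spectralSubspace_zero.mpr (one_mem _)
  | succ n ih =>
    rw [zpow_add, zpow_one]
    exact mul_mem_spectralSubspace ih hv
  | pred n ih =>
    rw [sub_eq_add_neg, zpow_add, zpow_neg_one]
    exact mul_mem_spectralSubspace ih hinv

/-- Every trigonometric polynomial has evaluations in the fixed point algebra. -/
lemma exists_isEvaluation (hu1 : ∀ j, (u j : A) ∈ α.spectralSubspace 1) {a : A}
    (ha : a ∈ ⨆ n, α.spectralSubspace n) :
    ∃ N x, IsEvaluation α l u N a x ∧ ∀ j, x j ∈ α.fixedPointAlgebra := by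
  induction ha using Submodule.iSup_induction' with
  | mem n a ha =>
    refine ⟨_, _, IsEvaluation.of_mem ha, fun j => ?_⟩
    rw [← mem_spectralSubspace_zero, ← add_neg_cancel n]
    exact mul_mem_spectralSubspace ha (zpow_mem_spectralSubspace (hu1 j) (-n))
  | zero => exact ⟨_, _, IsEvaluation.of_mem_zero (zero_mem _), fun j => zero_mem _⟩
  | add a b _ _ iha ihb =>
    obtain ⟨M, x, hx, hx'⟩ := iha
    obtain ⟨N, y, hy, hy'⟩ := ihb
    exact ⟨_, _, hx.add hy, fun j => add_mem (hx' j) (hy' j)⟩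

end NormControl

/-! ### Transfer from the algebra to its fixed points. -/

/-- Two-sided invertibility in products passes to the fixed point algebra of a Rokhlin action. -/
lemma HasRokhlinProperty.exists_mul_mul_eq_one [Nontrivial A] (hα : α.HasRokhlinProperty)
    (a : α.fixedPointAlgebra) (ha : ∃ x y : A, x * a * y = 1) :
    ∃ x y : α.fixedPointAlgebra, x * a * y = 1 := by
  obtain ⟨x, y, hxy⟩ := ha
  obtain ⟨z, hz⟩ := exists_star_mul_mul_eq_one hxy
  obtain ⟨u, hu, hu1, huc⟩ := hα.exists_net
  let v : Finset A × ℕ → unitary A := fun j => ⟨u j, hu j⟩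
  have hv : ∀ a : A, Filter.Tendsto (fun j => (v j : A) * a - a * v j) Filter.atTop (nhds 0) := huc
  have hdense : Dense ((⨆ n, α.spectralSubspace n : Submodule ℂ A) : Set A) := by
    rw [Submodule.dense_iff_topologicalClosure_eq_top]
    exact α.dense_span_spectralSubspace
  -- Being within distance one of `1` is an open condition, so `z` may be replaced by a
  -- trigonometric polynomial.
  have hopen : IsOpen {z : A | ‖star z * (star (a : A) * a) * z + -1‖ < 1} :=
    isOpen_lt (by fun_prop) continuous_const
  obtain ⟨z', hz1, hz2⟩ := hdense.inter_open_nonempty _ hopen ⟨z, by simp [hz]⟩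
  obtain ⟨N, w, hw, hwm⟩ := exists_isEvaluation (l := Filter.atTop) (u := v) hu1 hz2
  have hamem : star (a : A) * a ∈ α.spectralSubspace 0 :=
    mem_spectralSubspace_zero.mpr (mul_mem (star_mem a.2) a.2)
  have hone : (-1 : A) ∈ α.spectralSubspace 0 :=
    mem_spectralSubspace_zero.mpr (neg_mem (one_mem _))
  -- Both `a⋆a` and `-1` have degree zero and evaluate to themselves, so asymptotic contractivity
  -- preserves the strict bound when `z'` is replaced by `w j`.
  have hev := ((((hw.star hv).mul hv (.of_mem_zero hamem)).mul hv hw).add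
    (.of_mem_zero hone)).eventually_norm_lt hv hz1
  classical
  obtain ⟨j, hj⟩ := hev.exists
  let b : α.fixedPointAlgebra := ⟨w j, hwm j⟩
  have h1 : ‖1 - star b * (star a * a) * b‖ < 1 := by
    rw [← norm_neg, neg_sub, sub_eq_add_neg]
    exact hj
  have h2 : IsUnit (star b * (star a * a) * b) := by
    have := (Units.oneSub _ h1).isUnit
    simpa using this
  obtain ⟨U, hU⟩ := h2
  refine ⟨↑U⁻¹ * star b * star a, b, ?_⟩
  have h3 : (↑U⁻¹ : α.fixedPointAlgebra) * (star b * (star a * a) * b) = 1 := by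
    rw [← hU, U.inv_mul]
  rw [← h3]
  simp only [mul_assoc]

/-- The fixed point algebra of a Rokhlin action on a noncommutative algebra is not `ℂ`. -/
lemma HasRokhlinProperty.isEmpty_starAlgEquiv [Nontrivial A] (hα : α.HasRokhlinProperty)
    (hA : ¬ ∀ a b : A, a * b = b * a) : IsEmpty (α.fixedPointAlgebra ≃⋆ₐ[ℂ] ℂ) := by
  refine ⟨fun e => hA ?_⟩
  obtain ⟨u, hu, hu1, -⟩ := hα.exists_unitary one_pos ∅
  let v : unitary A := ⟨u, hu⟩
  -- If all fixed elements are scalars, multiplication by `u^(-n)` shows that degree `n` is spanned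
  -- by `uⁿ`; these powers commute.
  have hscalar : ∀ n (c : A), c ∈ α.spectralSubspace n →
      ∃ z : ℂ, c = z • ((v ^ n : unitary A) : A) := by
    intro n c hc
    have hb : c * (v ^ (-n) : unitary A) ∈ α.fixedPointAlgebra := by
      rw [← mem_spectralSubspace_zero, ← add_neg_cancel n]
      exact mul_mem_spectralSubspace hc (zpow_mem_spectralSubspace hu1 (-n))
    let b : α.fixedPointAlgebra := ⟨_, hb⟩
    have h1 : b = algebraMap ℂ _ (e b) := e.injective (show e b = e (algebraMap ℂ _ (e b)) by
      rw [Algebra.algebraMap_eq_smul_one, map_smul, map_one, smul_eq_mul, mul_one])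
    refine ⟨e b, ?_⟩
    have h2 : c * (v ^ (-n) : unitary A) = (e b) • (1 : A) := by
      have := congrArg Subtype.val h1
      rwa [Algebra.algebraMap_eq_smul_one] at this
    have h3 := congrArg (· * ((v ^ n : unitary A) : A)) h2
    simp only [mul_assoc, ← Submonoid.coe_mul, ← zpow_add, neg_add_cancel, zpow_zero,
      Submonoid.coe_one, mul_one, smul_mul_assoc, one_mul] at h3
    exact h3
  have hcomm : ∀ c ∈ ⨆ n, α.spectralSubspace n, ∀ d ∈ ⨆ n, α.spectralSubspace n,
      c * d = d * c := by
    intro c hc d hd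
    induction hc using Submodule.iSup_induction' with
    | mem m c hc =>
      induction hd using Submodule.iSup_induction' with
      | mem n d hd =>
        obtain ⟨z, rfl⟩ := hscalar m c hc
        obtain ⟨w, rfl⟩ := hscalar n d hd
        rw [smul_mul_smul_comm, smul_mul_smul_comm, ← Submonoid.coe_mul, ← Submonoid.coe_mul,
          ← zpow_add, ← zpow_add, add_comm, mul_comm z]
      | zero => simp
      | add x y _ _ hx hy => rw [mul_add, add_mul, hx, hy]
    | zero => simp
    | add x y _ _ hx hy => rw [mul_add, add_mul, hx, hy]
  have hdense : Dense ((⨆ n, α.spectralSubspace n : Submodule ℂ A) : Set A) := by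
    rw [Submodule.dense_iff_topologicalClosure_eq_top]
    exact α.dense_span_spectralSubspace
  intro a b
  refine hdense.induction (P := fun a => a * b = b * a) (fun c hc => ?_)
    (isClosed_eq (by fun_prop) (by fun_prop)) a
  exact hdense.induction (P := fun b => c * b = b * c) (fun d hd => hcomm c hc d hd)
    (isClosed_eq (by fun_prop) (by fun_prop)) b

/-- In a commutative algebra `x a y = 1` makes `a` invertible, whereas Gelfand–Mazur supplies a
nonzero noninvertible element. -/
lemma isKirchbergAlgebra_not_commutative (hA : IsKirchbergAlgebra A) :
    ¬ ∀ a b : A, a * b = b * a := by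
  intro hc
  have := hA.purelyInfiniteSimple.simple.nontrivial
  obtain ⟨a, ha, hau⟩ :=
    exists_not_isUnit_of_isEmpty_starAlgEquiv hA.purelyInfiniteSimple.not_complex
  obtain ⟨x, y, hxy⟩ := hA.purelyInfiniteSimple.exists_mul_mul_eq a 1 ha
  have h : a * (y * x) = 1 := by rw [← mul_assoc, hc, ← mul_assoc, hxy]
  exact hau ⟨⟨a, y * x, h, (hc _ _).trans h⟩, rfl⟩

end CircleAction

/-! ## Averaging -/

namespace CircleAction

/-- Integrals of positive functions are positive. -/
lemma integral_haar_nonneg {D : Type*} [NonUnitalCStarAlgebra D] [PartialOrder D]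
    [StarOrderedRing D] {G : Circle → D} (hG : ∀ ζ, 0 ≤ G ζ) : 0 ≤ ∫ ζ, G ζ ∂haar :=
  integral_nonneg hG

variable {A : Type*} [CStarAlgebra A] {α : CircleAction A}

variable (α) in
/-- Averaging over the circle, as a completely positive map. -/
def averageCP [PartialOrder A] [StarOrderedRing A] : A →CP A where
  toLinearMap := α.fourierCoeff 0
  map_cstarMatrix_nonneg' k M hM := by
    let G : Circle → CStarMatrix (Fin k) (Fin k) A := fun ζ => M.map (α ζ)
    have hG : ∀ ζ, 0 ≤ G ζ := fun ζ =>
      map_nonneg (CStarMatrix.mapₙₐ ((α ζ : A →⋆ₐ[ℂ] A) : A →⋆ₙₐ[ℂ] A)) hM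
    have hGc : Continuous G :=
      continuous_pi fun i => continuous_pi fun j => α.continuous_apply (M i j)
    have hGi : Integrable G haar :=
      hGc.integrable_of_hasCompactSupport (HasCompactSupport.of_compactSpace _)
    -- The matrix amplification of the average is the average of the amplified automorphisms,
    -- checked on entries.
    have h : M.map (α.fourierCoeff 0) = ∫ ζ, G ζ ∂haar := by
      ext i j
      let L : CStarMatrix (Fin k) (Fin k) A →L[ℂ] A :=
        LinearMap.mkContinuous
          { toFun := fun M => M i j, map_add' := fun _ _ => rfl, map_smul' := fun _ _ => rfl } 1
          fun M => by rw [one_mul]; exact CStarMatrix.norm_entry_le_norm (M := M) (i := i) (j := j)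
      refine Eq.trans ?_ (L.integral_comp_comm hGi)
      change α.fourierCoeff 0 (M i j) = ∫ ζ, α ζ (M i j) ∂haar
      simp [fourierCoeff_apply, character_zero]
    change 0 ≤ M.map (α.fourierCoeff 0)
    rw [h]
    exact integral_haar_nonneg hG

variable (α) in
/-- The fixed point algebra of a circle action on a nuclear C⋆-algebra is nuclear. -/
lemma isNuclear_fixedPointAlgebra (hA : IsNuclearCStar A) :
    IsNuclearCStar α.fixedPointAlgebra := by
  let _ : PartialOrder A := CStarAlgebra.spectralOrder A
  have : StarOrderedRing A := CStarAlgebra.spectralOrderedRing A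
  let _ : PartialOrder α.fixedPointAlgebra := CStarAlgebra.spectralOrder _
  have : StarOrderedRing α.fixedPointAlgebra := CStarAlgebra.spectralOrderedRing _
  let incl : α.fixedPointAlgebra →⋆ₙₐ[ℂ] A :=
    (α.fixedPointAlgebra.subtype : α.fixedPointAlgebra →⋆ₐ[ℂ] A)
  let f : A →ₗ[ℂ] α.fixedPointAlgebra :=
    { toFun a := ⟨α.fourierCoeff 0 a, mem_spectralSubspace_zero.mp (fourierCoeff_mem 0 a)⟩
      map_add' a b := Subtype.ext (map_add _ a b)
      map_smul' c a := Subtype.ext (map_smul _ c a) }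
  refine hA.of_approx fun F ε hε => ⟨CompletelyPositiveMap.ofStarHom incl,
    CompletelyPositiveMap.ofComp f incl Subtype.val_injective α.averageCP fun _ => rfl,
    fun _ => le_rfl, fun a => norm_fourierCoeff_le 0 a, fun a _ => ?_⟩
  have h : f (a : A) = a :=
    Subtype.ext (fourierCoeff_of_mem (mem_spectralSubspace_zero.mpr a.2))
  change ‖f (a : A) - a‖ < ε
  rwa [h, sub_self, norm_zero]

/-- The fixed point algebra of a Rokhlin action on a unital Kirchberg algebra is a Kirchberg
algebra. -/
theorem HasRokhlinProperty.isKirchbergAlgebra_fixedPointAlgebra (hα : α.HasRokhlinProperty)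
    (hA : IsKirchbergAlgebra A) : IsKirchbergAlgebra α.fixedPointAlgebra := by
  have hnA : Nontrivial A := hA.purelyInfiniteSimple.simple.nontrivial
  have hsep := hA.separable
  have : SecondCountableTopology A := UniformSpace.secondCountable_of_separable A
  refine ⟨.of_exists ⟨⟨0, 1, zero_ne_one⟩⟩
    (hα.isEmpty_starAlgEquiv (isKirchbergAlgebra_not_commutative hA)) fun a b ha => ?_,
    inferInstance, α.isNuclear_fixedPointAlgebra hA.nuclear⟩
  obtain ⟨x, y, hxy⟩ := hα.exists_mul_mul_eq_one a
    (hA.purelyInfiniteSimple.exists_mul_mul_eq _ 1 fun h => ha (Subtype.ext h))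
  exact ⟨x, y * b, by rw [← mul_assoc, hxy, one_mul]⟩

/-! ## The regular representation of the convolution algebra -/

namespace ConvAlg

variable (α) in
/-- Constant functions. -/
def const : A →ₗ[ℂ] ConvAlg α where
  toFun x := (ContinuousMap.const Circle x : C(Circle, A))
  map_add' _ _ := rfl
  map_smul' _ _ := rfl

lemma const_apply (x : A) (t : Circle) : const α x t = x := rfl

/-- The constants form a left ideal of the convolution algebra. The regular representation is the
action on this ideal, so its algebraic identities are inherited from convolution. -/
lemma mul_const_eq (f : ConvAlg α) (x : A) :
    f * const α x = const α (∫ s, f s * α s x ∂haar) := by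
  ext t; rfl

lemma star_const_mul_const (x y : A) :
    star (const α x) * const α y = const α (α.fourierCoeff 0 (star x * y)) := by
  rw [mul_const_eq, fourierCoeff_apply]
  simp [star_apply, const_apply, character_zero]

lemma const_injective : Function.Injective (const α) := fun x y h => by
  simpa [const_apply] using congrArg (fun f : ConvAlg α => f 1) h

end ConvAlg

/-! ### The Hilbert module over the fixed point algebra. -/

variable (α) in
/-- The algebra `A` with the norm of the Hilbert module over the fixed point algebra. -/
def RegularModule (_α : CircleAction A) : Type _ := A

namespace RegularModule

instance : AddCommGroup (RegularModule α) := inferInstanceAs (AddCommGroup A)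
instance : Module ℂ (RegularModule α) := inferInstanceAs (Module ℂ A)

/-- The inner product on `A` with values in the fixed point algebra. -/
def ip (α : CircleAction A) (x y : A) : A := α.fourierCoeff 0 (star x * y)

lemma ip_add_right (x y z : A) : ip α x (y + z) = ip α x y + ip α x z := by
  rw [ip, mul_add, map_add]; rfl

lemma ip_sub_right (x y z : A) : ip α x (y - z) = ip α x y - ip α x z := by
  rw [ip, mul_sub, map_sub]; rfl

lemma ip_smul_right (c : ℂ) (x y : A) : ip α x (c • y) = c • ip α x y := by
  rw [ip, mul_smul_comm, map_smul]; rfl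

lemma star_fourierCoeff_zero (x : A) :
    star (α.fourierCoeff 0 x) = α.fourierCoeff 0 (star x) := by
  simp only [fourierCoeff_apply, neg_zero, character_zero, one_smul, map_star]
  exact ((starL' ℝ (A := A)).toContinuousLinearMap.integral_comp_comm
    (integrable_haar (α.continuous_apply x))).symm

lemma star_ip (x y : A) : star (ip α x y) = ip α y x := by
  rw [ip, star_fourierCoeff_zero, star_mul, star_star]; rfl

lemma ip_mul_right (x y : A) {b : A} (hb : b ∈ α.fixedPointAlgebra) :
    ip α x (y * b) = ip α x y * b := by
  have hb' : ∀ ζ, α ζ b = b := hb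
  simp only [ip, fourierCoeff_apply, neg_zero, character_zero, one_smul, ← mul_assoc, map_mul, hb']
  have := (((ContinuousLinearMap.mul ℂ A).flip b)).integral_comp_comm
    (integrable_haar (α.continuous_apply (star x * y)))
  simpa [map_mul] using this

lemma ip_mem (x y : A) : ip α x y ∈ α.fixedPointAlgebra :=
  mem_spectralSubspace_zero.mp (fourierCoeff_mem 0 _)

section Order

variable [PartialOrder A] [StarOrderedRing A]

lemma fourierCoeff_zero_mono {x y : A} (h : x ≤ y) :
    α.fourierCoeff 0 x ≤ α.fourierCoeff 0 y := by
  rw [← sub_nonneg, ← map_sub]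
  simp only [fourierCoeff_apply, neg_zero, character_zero, one_smul]
  exact integral_haar_nonneg fun ζ => map_nonneg (α ζ) (sub_nonneg.mpr h)

lemma ip_self_nonneg (x : A) : 0 ≤ ip α x x := by
  have := fourierCoeff_zero_mono (α := α) (star_mul_self_nonneg x)
  rwa [map_zero] at this

/-- Cauchy–Schwarz for Hilbert modules: expand the positive inner square of `y - x (t Z)` with `Z =
⟨x, y⟩` and `t` close to `1/‖⟨x, x⟩‖`. -/
lemma norm_ip_sq_le_of_order (x y : A) : ‖ip α x y‖ ^ 2 ≤ ‖ip α x x‖ * ‖ip α y y‖ := by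
  set X := ip α x x with hX
  set Y := ip α y y with hY
  set Z := ip α x y with hZ
  have hYX : ip α y x = star Z := (star_ip x y).symm
  -- The parameter `δ` avoids dividing by `‖X‖` when it vanishes.
  have key : ∀ δ : ℝ, 0 < δ → ‖Z‖ ^ 2 ≤ (‖X‖ + δ) * ‖Y‖ := by
    intro δ hδ
    set t : ℝ := (‖X‖ + δ)⁻¹ with ht
    have ht0 : 0 < t := by positivity
    have hb : (t : ℂ) • Z ∈ α.fixedPointAlgebra := SMulMemClass.smul_mem _ (ip_mem x y)
    have h1 : 0 ≤ ip α (y - x * ((t : ℂ) • Z)) (y - x * ((t : ℂ) • Z)) := ip_self_nonneg _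
    have h2 : ip α (y - x * ((t : ℂ) • Z)) (y - x * ((t : ℂ) • Z)) =
        Y - (2 * t) • (star Z * Z) + t ^ 2 • (star Z * X * Z) := by
      have e1 : ∀ w, ip α (y - x * ((t : ℂ) • Z)) w = ip α y w - (t : ℂ) • (star Z * ip α x w) := by
        intro w
        rw [← star_ip, ip_sub_right, ip_mul_right _ _ hb, star_sub, star_ip, mul_smul_comm,
          star_smul, star_mul, star_ip, star_ip, Complex.star_def, Complex.conj_ofReal, hYX]
      rw [e1, ip_sub_right, ip_sub_right, ip_mul_right _ _ hb, ip_mul_right _ _ hb, hYX, ← hX, ← hY,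
        ← hZ]
      simp only [mul_smul_comm, mul_sub, smul_sub, smul_smul]
      simp only [← Complex.ofReal_mul, Complex.coe_smul, mul_assoc]
      module
    have h3 : star Z * X * Z ≤ ‖X‖ • (star Z * Z) :=
      CStarAlgebra.star_left_conjugate_le_norm_smul (IsSelfAdjoint.of_nonneg (ip_self_nonneg x))
    have h4 : t • (star Z * Z) ≤ Y := by
      rw [h2] at h1
      have h5 : t ^ 2 • (star Z * X * Z) ≤ t • (star Z * Z) := by
        calc t ^ 2 • (star Z * X * Z) ≤ t ^ 2 • ‖X‖ • (star Z * Z) :=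
              smul_le_smul_of_nonneg_left h3 (by positivity)
          _ = (t ^ 2 * ‖X‖) • (star Z * Z) := by rw [smul_smul]
          _ ≤ t • (star Z * Z) := by
            refine smul_le_smul_of_nonneg_right ?_ (star_mul_self_nonneg Z)
            have : t * (‖X‖ + δ) = 1 := inv_mul_cancel₀ (by positivity)
            nlinarith
      have h6 : 0 ≤ Y - (2 * t) • (star Z * Z) + t • (star Z * Z) :=
        h1.trans (by gcongr)
      rw [← sub_nonneg]
      convert h6 using 1
      module
    have h5 : ‖t • (star Z * Z)‖ ≤ ‖Y‖ :=
      CStarAlgebra.norm_le_norm_of_nonneg_of_le (smul_nonneg ht0.le (star_mul_self_nonneg Z)) h4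
    rw [norm_smul, CStarRing.norm_star_mul_self, Real.norm_of_nonneg ht0.le, ht,
      inv_mul_le_iff₀ (by positivity)] at h5
    rw [sq]
    exact h5
  refine le_of_forall_pos_le_add fun ε hε => ?_
  have h := key (ε / (‖Y‖ + 1)) (by positivity)
  have h2 : ε / (‖Y‖ + 1) * ‖Y‖ ≤ ε := by
    rw [div_mul_eq_mul_div, div_le_iff₀ (by positivity)]
    nlinarith [norm_nonneg Y]
  linarith

lemma norm_ip_mul_le_of_order (a x : A) : ‖ip α (a * x) (a * x)‖ ≤ ‖a‖ ^ 2 * ‖ip α x x‖ := by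
  have h1 : star (a * x) * (a * x) ≤ ‖star a * a‖ • (star x * x) := by
    have := CStarAlgebra.star_left_conjugate_le_norm_smul (a := x) (b := star a * a)
      (IsSelfAdjoint.star_mul_self a)
    simpa only [star_mul, mul_assoc] using this
  have h2 := CStarAlgebra.norm_le_norm_of_nonneg_of_le (ip_self_nonneg (α := α) (a * x))
    (fourierCoeff_zero_mono h1)
  rw [← Complex.coe_smul, map_smul, norm_smul, CStarRing.norm_star_mul_self] at h2
  simpa [sq, ip] using h2

end Order

lemma norm_ip_sq_le (x y : A) : ‖ip α x y‖ ^ 2 ≤ ‖ip α x x‖ * ‖ip α y y‖ := by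
  let _ : PartialOrder A := CStarAlgebra.spectralOrder A
  have : StarOrderedRing A := CStarAlgebra.spectralOrderedRing A
  exact norm_ip_sq_le_of_order x y

lemma norm_ip_mul_le (a x : A) : ‖ip α (a * x) (a * x)‖ ≤ ‖a‖ ^ 2 * ‖ip α x x‖ := by
  let _ : PartialOrder A := CStarAlgebra.spectralOrder A
  have : StarOrderedRing A := CStarAlgebra.spectralOrderedRing A
  exact norm_ip_mul_le_of_order a x

/-- Averaging is translation invariant, so the action is isometric for the module norm. -/
lemma ip_act (s : Circle) (x : A) : ip α (α s x) (α s x) = ip α x x := by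
  simp only [ip, fourierCoeff_apply, neg_zero, character_zero, one_smul, ← map_star, ← map_mul,
    act_act]
  exact integral_mul_right_eq_self (fun ζ => α ζ (star x * x)) s

/-- The norm `‖E(x⋆ x)‖ ^ (1 / 2)`. -/
def nrm (α : CircleAction A) (x : A) : ℝ := √‖ip α x x‖

lemma nrm_nonneg (x : A) : 0 ≤ nrm α x := Real.sqrt_nonneg _

lemma nrm_sq (x : A) : nrm α x ^ 2 = ‖ip α x x‖ := Real.sq_sqrt (norm_nonneg _)

lemma norm_ip_le (x y : A) : ‖ip α x y‖ ≤ nrm α x * nrm α y := by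
  refine le_of_pow_le_pow_left₀ two_ne_zero (mul_nonneg (nrm_nonneg x) (nrm_nonneg y)) ?_
  rw [mul_pow, nrm_sq, nrm_sq]
  exact norm_ip_sq_le x y

lemma nrm_mul_act_le (a : A) (s : Circle) (x : A) : nrm α (a * α s x) ≤ ‖a‖ * nrm α x := by
  refine le_of_pow_le_pow_left₀ two_ne_zero (mul_nonneg (norm_nonneg a) (nrm_nonneg x)) ?_
  rw [mul_pow, nrm_sq, nrm_sq, ← ip_act s x]
  exact norm_ip_mul_le a _

lemma nrm_add_le (x y : A) : nrm α (x + y) ≤ nrm α x + nrm α y := by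
  refine le_of_pow_le_pow_left₀ two_ne_zero (add_nonneg (nrm_nonneg x) (nrm_nonneg y)) ?_
  have h1 : ip α (x + y) (x + y) = ip α x x + ip α x y + (ip α y x + ip α y y) := by
    have : ∀ z, ip α (x + y) z = ip α x z + ip α y z := fun z => by
      rw [← star_ip, ip_add_right, star_add, star_ip, star_ip]
    rw [this, ip_add_right, ip_add_right]
  rw [nrm_sq, h1]
  have h2 := norm_add_le (ip α x x + ip α x y) (ip α y x + ip α y y)
  have h3 := norm_add_le (ip α x x) (ip α x y)
  have h4 := norm_add_le (ip α y x) (ip α y y)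
  have h5 := norm_ip_le (α := α) x y
  have h6 := norm_ip_le (α := α) y x
  have h7 := nrm_sq (α := α) x
  have h8 := nrm_sq (α := α) y
  nlinarith

lemma nrm_zero : nrm α (0 : A) = 0 := by simp [nrm, ip]

lemma nrm_neg (x : A) : nrm α (-x) = nrm α x := by simp [nrm, ip]

instance : SeminormedAddCommGroup (RegularModule α) :=
  AddGroupSeminorm.toSeminormedAddCommGroup
    { toFun := nrm (A := A) α
      map_zero' := nrm_zero (A := A)
      add_le' := nrm_add_le (A := A)
      neg' := nrm_neg (A := A) }

lemma nrm_smul_le (c : ℂ) (x : A) : nrm α (c • x) ≤ ‖c‖ * nrm α x := by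
  refine le_of_pow_le_pow_left₀ two_ne_zero (mul_nonneg (norm_nonneg c) (nrm_nonneg x)) ?_
  rw [mul_pow, nrm_sq, nrm_sq]
  have h : ip α (c • x) (c • x) = (star c * c) • ip α x x := by
    rw [ip_smul_right, ← star_ip, ip_smul_right, star_smul, star_ip, smul_smul, mul_comm]
  rw [h, norm_smul, norm_mul, norm_star, sq]

instance : NormedSpace ℂ (RegularModule α) where
  norm_smul_le c x := nrm_smul_le (A := A) c x

/-! ### Boundedness and C⋆-identity of the regular representation. -/

/-- The action of the convolution algebra on `A`. -/
def opFun (f : ConvAlg α) (x : A) : A := ∫ s, f s * α s x ∂haar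

lemma integrable_op (f : ConvAlg α) (x : A) : Integrable (fun s => f s * α s x) haar :=
  integrable_haar (f.continuous.mul (α.continuous_apply x))

lemma const_opFun (f : ConvAlg α) (x : A) :
    ConvAlg.const α (opFun f x) = f * ConvAlg.const α x :=
  (ConvAlg.mul_const_eq f x).symm

lemma const_ip (x y : A) :
    ConvAlg.const α (ip α x y) = star (ConvAlg.const α x) * ConvAlg.const α y :=
  (ConvAlg.star_const_mul_const x y).symm

lemma opFun_mul (f g : ConvAlg α) (x : A) : opFun (f * g) x = opFun f (opFun g x) :=
  ConvAlg.const_injective (by rw [const_opFun, const_opFun, const_opFun, mul_assoc])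

lemma ip_opFun (f : ConvAlg α) (x y : A) : ip α (opFun f x) y = ip α x (opFun (star f) y) :=
  ConvAlg.const_injective (by
    rw [const_ip, const_ip, const_opFun, const_opFun, star_mul, mul_assoc])

/-- Pair `w = opFun f x` with itself and apply Cauchy–Schwarz under the integral; a factor `nrm α w`
then cancels. This is the domination by the `L¹`-norm. -/
lemma nrm_opFun_le (f : ConvAlg α) (x : A) :
    nrm α (opFun f x) ≤ (∫ t, ‖f t‖ ∂haar) * nrm α x := by
  set w := opFun f x with hw
  have h1 : ip α w w = ∫ s, ip α w (f s * α s x) ∂haar := by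
    let L : A →L[ℂ] A := LinearMap.mkContinuous
      { toFun := fun y => ip α w y, map_add' := ip_add_right w,
        map_smul' := fun c y => ip_smul_right c w y } ‖w‖ fun y => by
          refine (norm_fourierCoeff_le 0 _).trans ((norm_mul_le _ _).trans ?_)
          rw [norm_star]
    exact (L.integral_comp_comm (integrable_op f x)).symm
  have hint : Integrable (fun s => nrm α w * (‖f s‖ * nrm α x)) haar :=
    Continuous.integrable_of_hasCompactSupport (by fun_prop) (HasCompactSupport.of_compactSpace _)
  have h2 : nrm α w ^ 2 ≤ nrm α w * ((∫ t, ‖f t‖ ∂haar) * nrm α x) := by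
    rw [nrm_sq, h1]
    refine (norm_integral_le_of_norm_le hint (Filter.Eventually.of_forall fun s => ?_)).trans
      (le_of_eq ?_)
    · exact (norm_ip_le _ _).trans
        (mul_le_mul_of_nonneg_left (nrm_mul_act_le _ _ _) (nrm_nonneg _))
    · rw [integral_const_mul, integral_mul_const]
  rcases (nrm_nonneg (α := α) w).eq_or_lt with h0 | h0
  · rw [← h0]
    exact mul_nonneg (integral_nonneg fun _ => norm_nonneg _) (nrm_nonneg x)
  · rw [sq] at h2
    exact le_of_mul_le_mul_left h2 h0

lemma opFun_add_right (f : ConvAlg α) (x y : A) : opFun f (x + y) = opFun f x + opFun f y :=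
  ConvAlg.const_injective (by
    rw [const_opFun, map_add, mul_add, ← const_opFun, ← const_opFun, ← map_add])

lemma opFun_smul_right (f : ConvAlg α) (c : ℂ) (x : A) : opFun f (c • x) = c • opFun f x :=
  ConvAlg.const_injective (by
    rw [const_opFun, map_smul, mul_smul_comm, ← const_opFun, ← map_smul])

lemma opFun_add_left (f g : ConvAlg α) (x : A) : opFun (f + g) x = opFun f x + opFun g x :=
  ConvAlg.const_injective (by
    rw [const_opFun, add_mul, ← const_opFun, ← const_opFun, ← map_add])

lemma opFun_smul_left (c : ℂ) (f : ConvAlg α) (x : A) : opFun (c • f) x = c • opFun f x :=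
  ConvAlg.const_injective (by
    rw [const_opFun, smul_mul_assoc, ← const_opFun, ← map_smul])

/-- The regular representation. -/
def op : ConvAlg α →ₗ[ℂ] (RegularModule α →L[ℂ] RegularModule α) where
  toFun f := LinearMap.mkContinuous
    { toFun := opFun (A := A) f
      map_add' := opFun_add_right (A := A) f
      map_smul' := opFun_smul_right (A := A) f } (∫ t, ‖f t‖ ∂haar) (nrm_opFun_le f)
  map_add' f g := ContinuousLinearMap.ext (opFun_add_left (A := A) f g)
  map_smul' c f := ContinuousLinearMap.ext (opFun_smul_left (A := A) c f)

lemma op_mul (f g : ConvAlg α) : op (f * g) = op f * op g := by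
  exact ContinuousLinearMap.ext (opFun_mul (A := A) f g)

/-- By adjointness `⟨f x, f x⟩ = ⟨x, f⋆f x⟩`, and Cauchy–Schwarz bounds the right-hand side. -/
lemma norm_op_le_of_star (f : ConvAlg α) : ‖op f‖ * ‖op f‖ ≤ ‖op (star f * f)‖ := by
  have key : ∀ x : A, nrm α (opFun f x) ≤ √‖op (star f * f)‖ * nrm α x := fun x => by
    refine le_of_pow_le_pow_left₀ two_ne_zero (mul_nonneg (Real.sqrt_nonneg _) (nrm_nonneg x)) ?_
    rw [mul_pow, Real.sq_sqrt (norm_nonneg _), nrm_sq, ip_opFun, ← opFun_mul]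
    refine (norm_ip_le _ _).trans ?_
    have h1 : nrm α (opFun (star f * f) x) ≤ ‖op (star f * f)‖ * nrm α x :=
      (op (star f * f)).le_opNorm x
    nlinarith [nrm_nonneg (α := α) x]
  have h : ‖op f‖ ≤ √‖op (star f * f)‖ :=
    ContinuousLinearMap.opNorm_le_bound _ (Real.sqrt_nonneg _) key
  have := mul_self_le_mul_self (norm_nonneg _) h
  rwa [Real.mul_self_sqrt (norm_nonneg _)] at this

lemma norm_op_le_norm_op_star (f : ConvAlg α) : ‖op f‖ ≤ ‖op (star f)‖ := by
  have h := (norm_op_le_of_star f).trans ((congrArg norm (op_mul _ _)).le.trans (norm_mul_le _ _))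
  rcases (norm_nonneg (op f)).eq_or_lt with h0 | h0
  · rw [← h0]; exact norm_nonneg _
  · exact le_of_mul_le_mul_right h h0

/-- The regular representation defines a C⋆-seminorm. -/
lemma isCStarSeminorm_op :
    ConvAlg.IsCStarSeminorm ((normSeminorm ℂ (RegularModule α →L[ℂ] RegularModule α)).comp op) where
  mul_le f g := (congrArg norm (op_mul f g)).le.trans (norm_mul_le _ _)
  star_mul_self f := by
    refine le_antisymm ?_ (norm_op_le_of_star f)
    refine (congrArg norm (op_mul _ _)).le.trans ((norm_mul_le _ _).trans ?_)
    have := norm_op_le_norm_op_star (star f)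
    rw [star_star] at this
    exact mul_le_mul_of_nonneg_right this (norm_nonneg _)
  le_integral_norm f := ContinuousLinearMap.opNorm_le_bound _
    (integral_nonneg fun _ => norm_nonneg _) (nrm_opFun_le f)

end RegularModule

/-- In the regular representation the constant `1` fixes the unit of `A`, a vector of norm one. This
keeps the crossed product from collapsing. -/
lemma ConvAlg.norm_const_one_ne_zero [Nontrivial A] : ‖ConvAlg.const α 1‖ ≠ 0 := by
  intro h
  have h1 := ConvAlg.le_universalSeminorm RegularModule.isCStarSeminorm_op (ConvAlg.const α 1)
  have h2 : ‖RegularModule.op (ConvAlg.const α 1)‖ ≤ 0 := h1.trans h.le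
  have h3 : RegularModule.nrm α (RegularModule.opFun (ConvAlg.const α 1) (1 : A)) ≤
      ‖RegularModule.op (ConvAlg.const α 1)‖ * RegularModule.nrm α (1 : A) :=
    (RegularModule.op (ConvAlg.const α 1)).le_opNorm (1 : A)
  have h4 : RegularModule.opFun (ConvAlg.const α 1) (1 : A) = 1 := by
    simp [RegularModule.opFun, ConvAlg.const_apply]
  have h5 : RegularModule.nrm α (1 : A) = 1 := by
    have : α.fourierCoeff 0 (1 : A) = 1 :=
      fourierCoeff_of_mem (mem_spectralSubspace_zero.mpr (one_mem _))
    rw [RegularModule.nrm, RegularModule.ip, star_one, one_mul, this, norm_one, Real.sqrt_one]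
  rw [h4, h5] at h3
  linarith

end CircleAction

/-! ## The crossed product as a stabilization -/

namespace CircleAction

variable {A : Type*} [CStarAlgebra A] {α : CircleAction A}

/-! ### Monomials in the convolution algebra. -/

namespace ConvAlg

variable (α) in
/-- The functions `t ↦ tⁿ c`. -/
def monomial (n : ℤ) : A →ₗ[ℂ] ConvAlg α where
  toFun c := (⟨fun t => character n t • c, by fun_prop⟩ : C(Circle, A))
  map_add' a b := by ext t; exact smul_add _ a b
  map_smul' z a := by ext t; exact smul_comm _ z a

lemma monomial_apply (n : ℤ) (c : A) (t : Circle) :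
    monomial α n c t = character n t • c := rfl

/-- The integrand is the fixed vector `t^j a c` times the character `s^(i + m - j)`, so
orthogonality of characters decides the product. -/
lemma monomial_mul_monomial (i j m : ℤ) (a : A) {c : A} (hc : c ∈ α.spectralSubspace m) :
    monomial α i a * monomial α j c = if i + m = j then monomial α j (a * c) else 0 := by
  ext t
  have h : ∀ s, monomial α i a s * α s (monomial α j c (s⁻¹ * t)) =
      character (i + m - j) s • (character j t • (a * c)) := by
    intro s
    rw [monomial_apply, monomial_apply, map_smul, hc s, character_mul, character_inv,
      sub_eq_add_neg, character_add, character_add, smul_mul_assoc, mul_smul_comm, mul_smul_comm]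
    simp only [smul_smul]
    congr 1
    ring
  rw [mul_apply]
  simp only [h]
  rw [integral_smul_const]
  split_ifs with hij
  · simp [hij, character_zero, monomial_apply]
  · rw [integral_character (sub_ne_zero.mpr hij), zero_smul, zero_apply]

lemma star_monomial (j m : ℤ) {c : A} (hc : c ∈ α.spectralSubspace m) :
    star (monomial α j c) = monomial α (j - m) (star c) := by
  ext t
  rw [star_apply, monomial_apply, monomial_apply, star_smul, star_character, character_inv,
    neg_neg, map_smul, star_mem_spectralSubspace hc t, smul_smul, sub_eq_add_neg, character_add]

lemma norm_le_of_forall_norm_le {f : ConvAlg α} {r : ℝ} (h : ∀ t, ‖f t‖ ≤ r) : ‖f‖ ≤ r := by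
  refine (isCStarSeminorm_universalSeminorm.le_integral_norm f).trans ?_
  have hi : Integrable (fun t => ‖f t‖) haar :=
    Continuous.integrable_of_hasCompactSupport (by fun_prop) (HasCompactSupport.of_compactSpace _)
  refine (integral_mono hi (integrable_const r) h).trans (le_of_eq ?_)
  simp

end ConvAlg

namespace CrossedProduct

open ConvAlg

variable (α) in
/-- The canonical map from continuous functions to the crossed product, as a bounded operator. -/
def ofContinuousMap : C(Circle, A) →L[ℂ] CrossedProduct α :=
  LinearMap.mkContinuous
    { toFun := fun f => of (show ConvAlg α from f)
      map_add' := fun f g => map_add (of (α := α)) f g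
      map_smul' := fun c f => map_smul (of (α := α)) c f } 1 fun f => by
      rw [one_mul]
      refine ((of (α := α)).norm_map _).le.trans ?_
      exact norm_le_of_forall_norm_le (α := α) fun t => f.norm_coe_le_norm t

lemma continuous_of_monomial (n : ℤ) : Continuous fun c : A => of (monomial α n c) := by
  refine AddMonoidHomClass.continuous_of_bound
    ((of (α := α)).toLinearMap ∘ₗ monomial α n) 1 fun c => ?_
  rw [one_mul]
  refine ((of (α := α)).norm_map _).le.trans ?_
  refine norm_le_of_forall_norm_le fun t => ?_
  rw [monomial_apply, norm_smul, norm_character, one_mul]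

/-- A closed subspace containing the monomials with spectral coefficients is everything. -/
lemma eq_top_of_monomial_mem (M : Submodule ℂ (CrossedProduct α))
    (hM : IsClosed (M : Set (CrossedProduct α)))
    (h : ∀ n m, ∀ c ∈ α.spectralSubspace m, of (monomial α n c) ∈ M) : M = ⊤ := by
  have h1 : ∀ n (c : A), of (monomial α n c) ∈ M := by
    intro n
    have hdense : Dense ((⨆ n, α.spectralSubspace n : Submodule ℂ A) : Set A) := by
      rw [Submodule.dense_iff_topologicalClosure_eq_top]
      exact α.dense_span_spectralSubspace
    refine hdense.induction (P := fun c => of (monomial α n c) ∈ M) (fun c hc => ?_)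
      (hM.preimage (continuous_of_monomial n))
    have : (⨆ n, α.spectralSubspace n) ≤
        M.comap ((of (α := α)).toLinearMap ∘ₗ monomial α n) :=
      iSup_le fun m c hc => h n m c hc
    exact this hc
  have h2 : ∀ f : C(Circle, A), ofContinuousMap α f ∈ M := by
    intro f
    -- Fourier analysis of the translation orbit of `f`: its coefficients are monomials, and its
    -- value at `1` is `f`.
    let F : C(Circle, C(Circle, A)) :=
      ContinuousMap.curry ⟨fun p : Circle × Circle => f (p.1 * p.2), by fun_prop⟩
    have hmem := mem_of_integral_character_smul_mem M hM (τ := fun s => ofContinuousMap α (F s))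
      (by fun_prop) (fun n => ?_) 1
    · have hF : F 1 = f := by ext t; simp [F]
      simpa only [hF] using hmem
    · have hc : Continuous fun s => character n s • F s := by fun_prop
      have hi : Integrable (fun s => character n s • F s) haar :=
        hc.integrable_of_hasCompactSupport (HasCompactSupport.of_compactSpace _)
      have e1 : ∫ s, character n s • ofContinuousMap α (F s) ∂haar =
          ofContinuousMap α (∫ s, character n s • F s ∂haar) := by
        rw [← (ofContinuousMap α).integral_comp_comm hi]
        simp only [map_smul]
      have e2 : ∫ s, character n s • F s ∂haar =
          (monomial α (-n) (∫ s, character n s • f s ∂haar) : ConvAlg α) := by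
        refine ContinuousMap.ext fun t => ?_
        have e3 := ((ContinuousMap.evalCLM ℂ t : C(Circle, A) →L[ℂ] A)).integral_comp_comm hi
        refine e3.symm.trans ?_
        change ∫ s, character n s • f (s * t) ∂haar =
          character (-n) t • ∫ s, character n s • f s ∂haar
        rw [← integral_smul, ← integral_mul_right_eq_self
          (fun s => character (-n) t • character n s • f s) t]
        congr 1 with s
        rw [character_mul, smul_smul, mul_left_comm, character_neg_mul_self, mul_one]
      rw [e1, e2]
      exact h1 _ _
  rw [eq_top_iff]
  rintro x -
  induction x using CrossedProduct.induction_on with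
  | hp => exact hM
  | h f => exact h2 f

/-! ### Matrix corners from an equivariant unitary. -/

lemma corner_mem {u : unitary A} (hu : (u : A) ∈ α.spectralSubspace 1) (i j : ℤ)
    (b : α.fixedPointAlgebra) :
    ((u ^ (-i) : unitary A) : A) * b * (u ^ j : unitary A) ∈ α.spectralSubspace (j - i) := by
  have := mul_mem_spectralSubspace (mul_mem_spectralSubspace (zpow_mem_spectralSubspace hu (-i))
    (mem_spectralSubspace_zero.mpr b.2)) (zpow_mem_spectralSubspace hu j)
  rwa [show -i + 0 + j = j - i by ring] at this

/-- The matrix corners of the crossed product defined by an equivariant unitary. -/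
def corner (u : unitary A) (i j : ℤ) : α.fixedPointAlgebra →ₗ[ℂ] CrossedProduct α where
  toFun b := of (monomial α j (((u ^ (-i) : unitary A) : A) * b * (u ^ j : unitary A)))
  map_add' a b := by
    rw [← map_add, ← map_add, ← add_mul, ← mul_add]; rfl
  map_smul' c b := by
    rw [RingHom.id_apply, ← map_smul, ← map_smul, ← smul_mul_assoc, ← mul_smul_comm]; rfl

lemma corner_apply (u : unitary A) (i j : ℤ) (b : α.fixedPointAlgebra) :
    corner u i j b =
      of (monomial α j (((u ^ (-i) : unitary A) : A) * b * (u ^ j : unitary A))) := rfl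

lemma corner_mul_corner {u : unitary A} (hu : (u : A) ∈ α.spectralSubspace 1) (i j j' k : ℤ)
    (a b : α.fixedPointAlgebra) :
    corner u i j a * corner u j' k b = if j = j' then corner u i k (a * b) else 0 := by
  rw [corner_apply, corner_apply, ← of_mul, monomial_mul_monomial _ _ _ _ (corner_mem hu j' k b)]
  by_cases h : j = j'
  · subst h
    rw [if_pos (by ring), if_pos rfl, corner_apply]
    congr 2
    have h1 : ((u ^ j : unitary A) : A) * (u ^ (-j) : unitary A) = 1 := by
      rw [← Submonoid.coe_mul, ← zpow_add, add_neg_cancel, zpow_zero, Submonoid.coe_one]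
    calc ((u ^ (-i) : unitary A) : A) * a * (u ^ j : unitary A) *
          (((u ^ (-j) : unitary A) : A) * b * (u ^ k : unitary A))
        = ((u ^ (-i) : unitary A) : A) * a *
          (((u ^ j : unitary A) : A) * (u ^ (-j) : unitary A)) * b * (u ^ k : unitary A) := by
            noncomm_ring
      _ = _ := by rw [h1, mul_one, mul_assoc ((u ^ (-i) : unitary A) : A)]; rfl
  · rw [if_neg (by omega), if_neg h, map_zero]

/-- The crossed product by a circle action with simple fixed point algebra and an equivariant
unitary is the stabilization of the fixed point algebra. -/
def stabilizationData [Nontrivial A] {u : unitary A} (hu : (u : A) ∈ α.spectralSubspace 1)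
    (hB : ∀ b : α.fixedPointAlgebra, b ≠ 0 → ∃ x y, x * b * y = 1) :
    StabilizationData α.fixedPointAlgebra (CrossedProduct α) where
  ι := corner u
  mul_same i j k a b := by rw [corner_mul_corner hu, if_pos rfl]
  mul_ne i j j' k a b h := by rw [corner_mul_corner hu, if_neg h]
  star_ι i j b := by
    rw [corner_apply, ← of_star, star_monomial _ _ (corner_mem hu i j b), corner_apply]
    have h : ∀ n : ℤ, star ((u ^ n : unitary A) : A) = ((u ^ (-n) : unitary A) : A) := fun n => by
      rw [← Unitary.coe_star, Unitary.star_eq_inv, zpow_neg]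
    rw [star_mul, star_mul, h, h, neg_neg, sub_sub_cancel, ← mul_assoc]
    rfl
  injective_zero := by
    rw [injective_iff_map_eq_zero]
    intro b hb
    by_contra hb0
    -- A nonzero element of the kernel would bring `1` into the kernel, against the nonvanishing
    -- norm of the constant function `1`.
    obtain ⟨x, y, hxy⟩ := hB b hb0
    have h1 : corner u 0 0 (x * b * y) = 0 := by
      have : corner u 0 0 x * corner u 0 0 b * corner u 0 0 y = corner u 0 0 (x * b * y) := by
        rw [corner_mul_corner hu, if_pos rfl, corner_mul_corner hu, if_pos rfl]
      rw [← this, hb, mul_zero, zero_mul]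
    rw [hxy, corner_apply] at h1
    have h2 : monomial α 0 (((u ^ (-0 : ℤ) : unitary A) : A) * (1 : α.fixedPointAlgebra) *
        (u ^ (0 : ℤ) : unitary A)) = const α 1 := by
      ext t
      simp [monomial_apply, const_apply, character_zero]
    rw [h2] at h1
    have h3 := (of (α := α)).norm_map (const α 1)
    rw [h1, norm_zero] at h3
    exact norm_const_one_ne_zero h3.symm
  dense_span := by
    refine eq_top_of_monomial_mem _ (Submodule.isClosed_topologicalClosure _) fun n m c hc => ?_
    apply Submodule.le_topologicalClosure
    apply Submodule.subset_span
    simp only [Set.mem_iUnion, Set.mem_range]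
    have hb : ((u ^ (n - m) : unitary A) : A) * c * (u ^ (-n) : unitary A) ∈
        α.fixedPointAlgebra := by
      have := mul_mem_spectralSubspace (mul_mem_spectralSubspace
        (zpow_mem_spectralSubspace hu (n - m)) hc) (zpow_mem_spectralSubspace hu (-n))
      rw [← mem_spectralSubspace_zero]
      rwa [show n - m + m + -n = 0 by ring] at this
    -- With `c` of degree `m`, the corner `t^n u^(-i) b u^n` has coefficient degree `n - i`, which
    -- forces `i = n - m`.
    refine ⟨n - m, n, ⟨_, hb⟩, ?_⟩
    rw [corner_apply]
    congr 2
    have h : ∀ k l : ℤ, k + l = 0 → ((u ^ k : unitary A) : A) * (u ^ l : unitary A) = 1 := by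
      intro k l hkl
      rw [← Submonoid.coe_mul, ← zpow_add, hkl, zpow_zero, Submonoid.coe_one]
    calc ((u ^ (-(n - m)) : unitary A) : A) *
          (((u ^ (n - m) : unitary A) : A) * c * (u ^ (-n) : unitary A)) * (u ^ n : unitary A)
        = ((u ^ (-(n - m)) : unitary A) : A) * ((u ^ (n - m) : unitary A) : A) * c *
          (((u ^ (-n) : unitary A) : A) * (u ^ n : unitary A)) := by noncomm_ring
      _ = c := by rw [h _ _ (by ring), h _ _ (by ring), one_mul, mul_one]

end CrossedProduct

end CircleAction

end

theorem mainTheorem4 {A : Type*} [CStarAlgebra A] (α : CircleAction A)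
    (hA : IsKirchbergAlgebra A) (hα : α.HasRokhlinProperty) :
    IsKirchbergAlgebra α.fixedPointAlgebra ∧ IsKirchbergAlgebra α.CrossedProduct := by
  have hB := hα.isKirchbergAlgebra_fixedPointAlgebra hA
  have : Nontrivial A := hA.purelyInfiniteSimple.simple.nontrivial
  obtain ⟨u, hu, hu1, -⟩ := hα.exists_unitary one_pos ∅
  exact ⟨hB, (CircleAction.CrossedProduct.stabilizationData (u := ⟨u, hu⟩) hu1 fun b hb =>
    hB.purelyInfiniteSimple.exists_mul_mul_eq b 1 hb).isKirchbergAlgebra hB⟩
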